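/- Let $\mathbb{S}^1=\mathbb{R}/\mathbb{Z}$ with its usual distance $|\cdot-\cdot|$, and let $\mathrm{Hom}(\mathbb{S}^1)$ be the group of homeomorphisms of $\mathbb{S}^1$ with the Borel $\sigma$-algebra of uniform convergence. Let $\mu$ be a Borel probability measure on $\mathrm{Hom}(\mathbb{S}^1)$ and let $\nu$ be a $\mu$-stationary Borel probability measure on $\mathbb{S}^1$, i.e. $\nu=\int T_*\nu\,d\mu(T)$. For $x=(x_n)_{n\ge 0}\in \mathrm{Hom}(\mathbb{S}^1)^{\mathbb{N}}$ put $\Phi_n(x)=x_{n-1}\circ\cdots\circ x_0$, let $\overline M=\mu^{\otimes\mathbb{N}}\times\nu$ on $\mathrm{Hom}(\mathbb{S}^1)^{\mathbb{N}}\times\mathbb{S}^1$, and define the local contraction exponent \[ \gamma(x,\xi)=\liminf_{\eta\to\xi,\ \eta\ne\xi}\ \liminf_{n\to\infty}\ -\frac1n\log\bigl|\Phi_n(x)\eta-\Phi_n(x)\xi\bigr|\ \in[0,+\infty]. \] Define the Furstenberg entropy \[ \kappa(\mu,\nu)=\int\!\!\int\log\frac{dT_*\nu}{d\nu}(T\xi)\,d\nu(\xi)\,d\mu(T),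 \] with $\kappa(\mu,\nu)=+\infty$ if $T_*\nu$ is not absolutely continuous with respect to $\nu$ for a set of $T$ of positive $\mu$-measure, or if the integrand is not integrable (its negative part always is in the absolutely continuous case). Then \[ \kappa(\mu,\nu)\ \le\ \int\gamma(x,\xi)\,d\overline M(x,\xi) \] (both sides may be $+\infty$). Moreover, if $\gamma(x,\xi)=0$ for $\overline M$-a.e. $(x,\xi)$, then $T_*\nu=\nu$ for $\mu$-a.e. $T$. -/

import Mathlib

open MeasureTheory Filter Topology
open scoped ENNReal

/-- The group of homeomorphisms of the circle `ℝ / ℤ` (not necessarily orientation preserving). -/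
abbrev CircleHomeo : Type := UnitAddCircle ≃ₜ UnitAddCircle

namespace CircleHomeo

/-- The topology of uniform convergence on the homeomorphism group of the circle, induced from the
compact-open topology on continuous self-maps. -/
instance instTopologicalSpace : TopologicalSpace CircleHomeo :=
  TopologicalSpace.induced (fun T : CircleHomeo => (T : C(UnitAddCircle, UnitAddCircle)))
    inferInstance

/-- Homeomorphisms of the circle carry the Borel sigma-algebra of uniform convergence. -/
instance instMeasurableSpace : MeasurableSpace CircleHomeo := borel CircleHomeo

instance instBorelSpace : BorelSpace CircleHomeo := ⟨rfl⟩

end CircleHomeo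

namespace RandomCircle

/-- The random compositions `Φ_n(x) = x_{n-1} ∘ ⋯ ∘ x_0`, with `Φ_0(x) = id`. -/
def iterate (x : ℕ → CircleHomeo) : ℕ → CircleHomeo
  | 0 => Homeomorph.refl UnitAddCircle
  | n + 1 => (iterate x n).trans (x n)

/-- `ν` is `μ`-stationary: `ν = ∫ T_* ν dμ(T)`, evaluated on Borel sets. -/
def IsStationary (μ : Measure CircleHomeo) (ν : Measure UnitAddCircle) : Prop :=
  ∀ A : Set UnitAddCircle, MeasurableSet A → ν A = ∫⁻ T, ν.map T A ∂μ

/-- The measure `μ^ℕ × ν` on `(homeomorphisms)^ℕ × circle`. -/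
noncomputable def pathMeasure (μ : Measure CircleHomeo) [IsProbabilityMeasure μ]
    (ν : Measure UnitAddCircle) : Measure ((ℕ → CircleHomeo) × UnitAddCircle) :=
  (Measure.infinitePi (fun _ : ℕ => μ)).prod ν

/-- The local contraction exponent
`γ(x, ξ) = liminf_{η → ξ, η ≠ ξ} liminf_{n → ∞} -(1/n) log |Φ_n(x) η - Φ_n(x) ξ|`,
an extended real number. -/
noncomputable def contractionExponent (x : ℕ → CircleHomeo) (ξ : UnitAddCircle) : EReal :=
  liminf (fun η : UnitAddCircle =>
    liminf (fun n : ℕ =>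
      ((-(1 / (n : ℝ)) * Real.log (dist (iterate x n η) (iterate x n ξ)) : ℝ) : EReal)) atTop)
    (𝓝[≠] ξ)

/-- The local contraction exponent is nonnegative, so that passing to `ℝ≥0∞` loses nothing. -/
theorem contractionExponent_nonneg (x : ℕ → CircleHomeo) (ξ : UnitAddCircle) :
    0 ≤ contractionExponent x ξ := by
  refine le_liminf_of_le (by isBoundedDefault) (Eventually.of_forall fun η => ?_)
  refine le_liminf_of_le (by isBoundedDefault) (Eventually.of_forall fun n => ?_)
  have h1 : dist (iterate x n η) (iterate x n ξ) ≤ 1 := by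
    rw [dist_eq_norm]
    have h := AddCircle.norm_le_half_period (1 : ℝ) (x := iterate x n η - iterate x n ξ) one_ne_zero
    norm_num at h
    linarith
  have h2 : Real.log (dist (iterate x n η) (iterate x n ξ)) ≤ 0 :=
    Real.log_nonpos dist_nonneg h1
  have h3 : (0 : ℝ) ≤ 1 / (n : ℝ) := by positivity
  have h4 : (0 : ℝ) ≤ -(1 / (n : ℝ)) * Real.log (dist (iterate x n η) (iterate x n ξ)) := by
    nlinarith
  exact_mod_cast h4

/-- The integral `∫ γ d(μ^ℕ × ν)` of the (nonnegative) local contraction exponent. -/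
noncomputable def integralContractionExponent (μ : Measure CircleHomeo) [IsProbabilityMeasure μ]
    (ν : Measure UnitAddCircle) : ℝ≥0∞ :=
  ∫⁻ p, (contractionExponent p.1 p.2).toENNReal ∂(pathMeasure μ ν)

/-- `log (dT_*ν / dν) (T ξ)`. -/
noncomputable def logDensity (ν : Measure UnitAddCircle) (T : CircleHomeo) (ξ : UnitAddCircle) :
    ℝ :=
  Real.log ((ν.map T).rnDeriv ν (T ξ)).toReal

open Classical in
/-- The Furstenberg entropy `κ(μ, ν) = ∫ log (dT_*ν / dν) (T ξ) dν(ξ) dμ(T)`. It is `+∞` if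
`T_*ν` fails to be absolutely continuous with respect to `ν` for a set of `T` of positive measure.
Otherwise it is the integral of the positive part minus the integral of the negative part; the
latter is at most `1 / e`, so the difference is always meaningful, and it is `+∞` exactly when the
integrand is not integrable. -/
noncomputable def furstenbergEntropy (μ : Measure CircleHomeo) (ν : Measure UnitAddCircle) :
    EReal :=
  if ∀ᵐ T : CircleHomeo ∂μ, ν.map T ≪ ν then
    ((∫⁻ T, ∫⁻ ξ, ENNReal.ofReal (logDensity ν T ξ) ∂ν ∂μ : ℝ≥0∞) : EReal) -
      ((∫⁻ T, ∫⁻ ξ, ENNReal.ofReal (-logDensity ν T ξ) ∂ν ∂μ : ℝ≥0∞) : EReal)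
  else ⊤

end RandomCircle

/-! Let q(T, ·) be the density with respect to ν of the absolutely continuous part of J ↦ ν(TJ). If
T_*ν ≪ ν, the integrand of the entropy at (T, ξ) is −log q(T, ξ) (`ae_logDensity_eq`): the
exponential rate at which T shrinks the ν-measure of infinitesimal arcs at ξ. The point is that
along a typical orbit small arcs really shrink at this rate, first in measure and then in length.

To pass from infinitesimal to actual arcs, q is replaced by the maximal ratio ν(TJ)/ν(J) over arcs J
∋ ξ with ν(J) < 1/m. On the circle a covering argument with multiplicity two gives a weak type bound
(`mul_measure_sUnion_le_of_isArc`). Hence the logarithm of the maximal ratio is integrable once it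
is truncated from below, and its infimum over m is at most q almost everywhere
(`ae_iInf_maxRatio_le`).

The skew product over the shift preserves the path measure, and a consequence of the maximal ergodic
theorem bounds the integral of the truncated rate by the integral of the largest c for which all
Birkhoff sums satisfy S_n ≥ cn − C (`ofReal_integral_le_lintegral_lowerRate`). A bound valid for
every n is what an induction needs: an arc about ξ of measure below e^{-C}/m (for m ≥ 1) never
leaves the range of the maximal ratio, so its images have measure at most e^{-cn}
(`exists_isArc_forall_measure_image_le`). The points lying in an arc of measure ≤ ε that escapes the
r-ball have total measure of order ε/r, and each Φ_n(x)ξ has law ν. Borel–Cantelli with ε = e^{-cn},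
r = e^{-c'n}, c' < c, turns decay of measure into decay of length, so γ ≥ c'.

Atoms have no small arcs around them, but almost every T preserves the masses of atoms, so q ≥ 1
there and atoms add nothing positive to the entropy. Letting m → ∞ and then removing the truncation
gives the inequality; if absolute continuity fails, q vanishes on a set of positive measure and the
truncated integrals blow up. If γ = 0, then −∫ log q ≤ 0 (truncated) while ∫ q ≤ 1, and the equality
case of log q ≤ q − 1 forces q = 1. -/

namespace RandomCircle

/-! ### Arcs, coverings of multiplicity two and the weak type inequality. -/

/-- Open preconnected subsets of the circle. -/
def IsArc (J : Set UnitAddCircle) : Prop := IsOpen J ∧ IsPreconnected J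

theorem IsArc.image {J : Set UnitAddCircle} (hJ : IsArc J) (T : CircleHomeo) : IsArc (T '' J) :=
  ⟨T.isOpenMap J hJ.1, hJ.2.image T T.continuous.continuousOn⟩

theorem isOpenMap_add_coe (x : UnitAddCircle) :
    IsOpenMap (fun t : ℝ => x + (t : UnitAddCircle)) :=
  (Homeomorph.addLeft x).isOpenMap.comp QuotientAddGroup.isOpenMap_coe

theorem exists_eq_add_coe (x y : UnitAddCircle) (a : ℝ) :
    ∃ t ∈ Set.Ico a (a + 1), y = x + (t : UnitAddCircle) := by
  refine ⟨AddCircle.equivIco 1 a (y - x), (AddCircle.equivIco 1 a (y - x)).2, ?_⟩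
  rw [AddCircle.coe_equivIco]
  abel

/-- A preconnected subset of the circle containing two points contains one of any two points that
separate them. -/
theorem mem_or_mem_of_isPreconnected {U : Set UnitAddCircle} (hU : IsPreconnected U)
    {x : UnitAddCircle} {a b c : ℝ} (ha : 0 < a) (hab : a < b) (hbc : b < c) (hc : c < 1)
    (hx : x ∈ U) (hb : x + (b : UnitAddCircle) ∈ U) :
    x + (a : UnitAddCircle) ∈ U ∨ x + (c : UnitAddCircle) ∈ U := by
  by_contra! h
  obtain ⟨hxa, hxc⟩ := h
  set f : ℝ → UnitAddCircle := fun t => x + (t : UnitAddCircle) with hf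
  obtain ⟨z, -, ⟨t, ht, rfl⟩, t', ht', htt⟩ := hU (f '' Set.Ioo a c) (f '' Set.Ioo c (a + 1))
    (isOpenMap_add_coe x _ isOpen_Ioo) (isOpenMap_add_coe x _ isOpen_Ioo)
    (by
      intro y hy
      obtain ⟨t, ht, rfl⟩ := exists_eq_add_coe x y a
      have h1 : t ≠ a := by rintro rfl; exact hxa hy
      have h2 : t ≠ c := by rintro rfl; exact hxc hy
      rcases lt_or_gt_of_ne h2 with h | h
      · exact Or.inl ⟨t, ⟨lt_of_le_of_ne ht.1 h1.symm, h⟩, rfl⟩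
      · exact Or.inr ⟨t, ⟨h, ht.2⟩, rfl⟩)
    ⟨x + (b : UnitAddCircle), hb, b, ⟨hab, hbc⟩, rfl⟩
    ⟨x, hx, 1, ⟨hc, by linarith⟩, by simp [hf]⟩
  have h3 : (t' : UnitAddCircle) = (t : UnitAddCircle) := add_left_cancel htt
  have h4 := (AddCircle.coe_eq_coe_iff_of_mem_Ico (p := (1 : ℝ)) (a := a)
    ⟨by linarith [ht'.1, ht.1], ht'.2⟩ ⟨ht.1.le, by linarith [ht.2]⟩).1 h3
  linarith [ht'.1, ht.2]

theorem exists_isArc_subset {ξ : UnitAddCircle} {O : Set UnitAddCircle} (hO : O ∈ 𝓝 ξ) :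
    ∃ J ⊆ O, IsArc J ∧ ξ ∈ J := by
  have : LocallyPathConnectedSpace UnitAddCircle :=
    IsQuotientMap.locallyPathConnectedSpace
      (QuotientAddGroup.isQuotientMap_mk (AddSubgroup.zmultiples (1 : ℝ)))
  obtain ⟨V, hVO, hV, hξ, hc⟩ := locallyConnectedSpace_iff_subsets_isOpen_isConnected.1
    (inferInstance : LocallyConnectedSpace UnitAddCircle) ξ O hO
  exact ⟨V, hVO, ⟨hV, hc.isPreconnected⟩, hξ⟩

/-- Among three preconnected subsets of the circle through a common point, one is contained in the
union of the other two. -/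
theorem not_three_private_points {U₁ U₂ U₃ : Set UnitAddCircle} (h₁ : IsPreconnected U₁)
    (h₂ : IsPreconnected U₂) (h₃ : IsPreconnected U₃) {x y₁ y₂ y₃ : UnitAddCircle}
    (hx₁ : x ∈ U₁) (hx₂ : x ∈ U₂) (hx₃ : x ∈ U₃) (h11 : y₁ ∈ U₁) (h12 : y₁ ∉ U₂) (h13 : y₁ ∉ U₃)
    (h21 : y₂ ∉ U₁) (h22 : y₂ ∈ U₂) (h23 : y₂ ∉ U₃) (h31 : y₃ ∉ U₁) (h32 : y₃ ∉ U₂)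
    (h33 : y₃ ∈ U₃) : False := by
  have key : ∀ y : UnitAddCircle, y ≠ x → ∃ t : ℝ, 0 < t ∧ t < 1 ∧ y = x + (t : UnitAddCircle) := by
    intro y hy
    obtain ⟨t, ht, rfl⟩ := exists_eq_add_coe x y 0
    refine ⟨t, lt_of_le_of_ne ht.1 ?_, by linarith [ht.2], rfl⟩
    rintro rfl
    simp at hy
  obtain ⟨t₁, p₁, l₁, rfl⟩ := key y₁ (by rintro rfl; exact h12 hx₂)
  obtain ⟨t₂, p₂, l₂, rfl⟩ := key y₂ (by rintro rfl; exact h21 hx₁)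
  obtain ⟨t₃, p₃, l₃, rfl⟩ := key y₃ (by rintro rfl; exact h31 hx₁)
  have mid : ∀ {U : Set UnitAddCircle}, IsPreconnected U → x ∈ U → ∀ {a b c : ℝ}, 0 < a → c < 1 →
      a < b → b < c → x + (a : UnitAddCircle) ∉ U → x + (b : UnitAddCircle) ∈ U →
      x + (c : UnitAddCircle) ∉ U → False := by
    intro U hU hx a b c ha hc hab hbc h1 h2 h3
    rcases mem_or_mem_of_isPreconnected hU ha hab hbc hc hx h2 with h | h
    exacts [h1 h, h3 h]
  have n12 : t₁ ≠ t₂ := by rintro rfl; exact h12 h22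
  have n13 : t₁ ≠ t₃ := by rintro rfl; exact h13 h33
  have n23 : t₂ ≠ t₃ := by rintro rfl; exact h23 h33
  rcases lt_or_gt_of_ne n12 with a | a <;> rcases lt_or_gt_of_ne n13 with b | b <;>
    rcases lt_or_gt_of_ne n23 with c | c
  · exact mid h₂ hx₂ p₁ l₃ a c h12 h22 h32
  · exact mid h₃ hx₃ p₁ l₂ b c h13 h33 h23
  · linarith
  · exact mid h₁ hx₁ p₃ l₂ b a h31 h11 h21
  · exact mid h₁ hx₁ p₂ l₃ a b h21 h11 h31
  · linarith
  · exact mid h₃ hx₃ p₂ l₁ c b h23 h33 h13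
  · exact mid h₂ hx₂ p₃ l₁ c a h32 h22 h12

/-- A finite family of arcs can be thinned out, without changing its union, so that no point lies
in more than two of its members. -/
theorem exists_subfamily_multiplicity_le_two (s : Finset (Set UnitAddCircle))
    (hs : ∀ J ∈ s, IsPreconnected J) :
    ∃ t ⊆ s, ⋃₀ (t : Set (Set UnitAddCircle)) = ⋃₀ (s : Set (Set UnitAddCircle)) ∧
      ∀ x : UnitAddCircle, ∑ J ∈ t, J.indicator (1 : UnitAddCircle → ℝ≥0∞) x ≤ 2 := by
  classical
  have hne : (s.powerset.filter fun t : Finset (Set UnitAddCircle) =>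
      ⋃₀ (t : Set (Set UnitAddCircle)) = ⋃₀ (s : Set (Set UnitAddCircle))).Nonempty :=
    ⟨s, by simp⟩
  obtain ⟨t, ht, hmin⟩ := Finset.exists_min_image _ Finset.card hne
  simp only [Finset.mem_filter, Finset.mem_powerset] at ht hmin
  refine ⟨t, ht.1, ht.2, fun x => ?_⟩
  -- By minimality of the cardinality no member is redundant, so each has a private point; three
  -- members through one point are then impossible.
  have priv : ∀ J ∈ t, ∃ y ∈ J, ∀ J' ∈ t, J' ≠ J → y ∉ J' := by
    intro J hJ
    by_contra! hcon
    have := hmin (t.erase J) ⟨(Finset.erase_subset _ _).trans ht.1, by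
      rw [← ht.2]
      apply subset_antisymm
      · exact Set.sUnion_subset_sUnion (by simp)
      · rintro y ⟨J', hJ', hy⟩
        by_cases h : J' = J
        · obtain ⟨J'', h1, h2, h3⟩ := hcon y (h ▸ hy)
          exact ⟨J'', by simp [h1, h2], h3⟩
        · exact ⟨J', by simpa [h] using hJ', hy⟩⟩
    exact absurd (Finset.card_erase_lt_of_mem hJ) (not_lt.2 this)
  have h1 : ∑ J ∈ t, J.indicator (1 : UnitAddCircle → ℝ≥0∞) x
      = ((t.filter fun J => x ∈ J).card : ℝ≥0∞) := by
    simp [Set.indicator_apply]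
  rw [h1]
  by_contra! hcon
  have h2 : 2 < (t.filter fun J => x ∈ J).card := by exact_mod_cast hcon
  obtain ⟨U₁, m₁, U₂, m₂, U₃, m₃, d12, d13, d23⟩ := Finset.two_lt_card.1 h2
  simp only [Finset.mem_filter] at m₁ m₂ m₃
  obtain ⟨y₁, a₁, b₁⟩ := priv U₁ m₁.1
  obtain ⟨y₂, a₂, b₂⟩ := priv U₂ m₂.1
  obtain ⟨y₃, a₃, b₃⟩ := priv U₃ m₃.1
  exact not_three_private_points (hs _ (ht.1 m₁.1)) (hs _ (ht.1 m₂.1)) (hs _ (ht.1 m₃.1))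
    m₁.2 m₂.2 m₃.2 a₁ (b₁ _ m₂.1 d12.symm) (b₁ _ m₃.1 d13.symm) (b₂ _ m₁.1 d12) a₂
    (b₂ _ m₃.1 d23.symm) (b₃ _ m₁.1 d13) (b₃ _ m₂.1 d23) a₃

/-- The weak type inequality for the maximal function over arcs. -/
theorem mul_measure_sUnion_le_of_isArc (ν ρ : Measure UnitAddCircle) [IsFiniteMeasure ν]
    (l : ℝ≥0∞) {𝒥 : Set (Set UnitAddCircle)} (h𝒥 : ∀ J ∈ 𝒥, IsArc J ∧ l * ν J ≤ ρ J) :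
    l * ν (⋃₀ 𝒥) ≤ 2 * ρ (⋃₀ 𝒥) := by
  classical
  have hopen : IsOpen (⋃₀ 𝒥) := isOpen_sUnion fun J hJ => (h𝒥 J hJ).1.1
  rw [hopen.measure_eq_iSup_isCompact ν]
  simp only [ENNReal.mul_iSup]
  refine iSup₂_le fun K hK => iSup_le fun hKc => ?_
  obtain ⟨s, hKs⟩ := hKc.elim_finite_subcover (fun J : 𝒥 => (J : Set UnitAddCircle))
    (fun J => (h𝒥 J J.2).1.1) (by rwa [← Set.sUnion_eq_iUnion])
  obtain ⟨t, hts, htU, hmult⟩ := exists_subfamily_multiplicity_le_two (s.image Subtype.val)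
    (by
      intro J hJ
      obtain ⟨J', -, rfl⟩ := Finset.mem_image.1 hJ
      exact (h𝒥 J' J'.2).1.2)
  have ht𝒥 : ∀ J ∈ t, J ∈ 𝒥 := by
    intro J hJ
    obtain ⟨J', -, rfl⟩ := Finset.mem_image.1 (hts hJ)
    exact J'.2
  have hKt : K ⊆ ⋃ J ∈ t, J := by
    intro x hx
    obtain ⟨J, hJs, hxJ⟩ := Set.mem_iUnion₂.1 (hKs hx)
    have : x ∈ ⋃₀ (t : Set (Set UnitAddCircle)) := by
      rw [htU]
      exact ⟨J, Finset.mem_coe.2 (Finset.mem_image_of_mem _ hJs), hxJ⟩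
    obtain ⟨J', h1, h2⟩ := this
    exact Set.mem_iUnion₂.2 ⟨J', h1, h2⟩
  calc l * ν K ≤ l * ∑ J ∈ t, ν J := by
        gcongr
        exact (measure_mono hKt).trans (measure_biUnion_finset_le _ _)
    _ = ∑ J ∈ t, l * ν J := Finset.mul_sum _ _ _
    _ ≤ ∑ J ∈ t, ρ J := Finset.sum_le_sum fun J hJ => (h𝒥 J (ht𝒥 J hJ)).2
    _ = ∑ J ∈ t, ∫⁻ x, J.indicator 1 x ∂ρ := by
        refine Finset.sum_congr rfl fun J hJ => ?_
        rw [lintegral_indicator_one (h𝒥 J (ht𝒥 J hJ)).1.1.measurableSet]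
    _ = ∫⁻ x, ∑ J ∈ t, J.indicator 1 x ∂ρ := by
        rw [lintegral_finsetSum]
        intro J hJ
        exact measurable_one.indicator (h𝒥 J (ht𝒥 J hJ)).1.1.measurableSet
    _ ≤ ∫⁻ x, (⋃₀ 𝒥).indicator (fun _ => 2) x ∂ρ := by
        refine lintegral_mono fun x => ?_
        by_cases hx : x ∈ ⋃₀ 𝒥
        · rw [Set.indicator_of_mem hx]
          exact hmult x
        · rw [Set.indicator_of_notMem hx, nonpos_iff_eq_zero]
          refine Finset.sum_eq_zero fun J hJ => Set.indicator_of_notMem (fun hxJ => hx ?_) _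
          exact ⟨J, ht𝒥 J hJ, hxJ⟩
    _ = 2 * ρ (⋃₀ 𝒥) := lintegral_indicator_const hopen.measurableSet _

/-! ### Measure against diameter of arcs, and differentiation along arcs. -/

/-- A compact subset with least element t lies in [t, b), which has measure at most ε because t
belongs to the set; inner regularity concludes. The next lemma is the mirror image, with greatest
elements. -/
theorem measure_setOf_measure_Ico_le (m : Measure ℝ) [IsFiniteMeasure m] (a b : ℝ) (ε : ℝ≥0∞) :
    m {t | t ∈ Set.Ico a b ∧ m (Set.Ico t b) ≤ ε} ≤ ε := by
  have hmeas : MeasurableSet {t | t ∈ Set.Ico a b ∧ m (Set.Ico t b) ≤ ε} := by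
    apply Set.OrdConnected.measurableSet
    refine ⟨fun x hx y hy z hz => ⟨⟨hx.1.1.trans hz.1, hz.2.trans_lt hy.1.2⟩, ?_⟩⟩
    exact (measure_mono (Set.Ico_subset_Ico_left hz.1)).trans hx.2
  rw [hmeas.measure_eq_iSup_isCompact m]
  refine iSup₂_le fun K hK => iSup_le fun hKc => ?_
  rcases K.eq_empty_or_nonempty with rfl | hne
  · simp
  obtain ⟨t, htK, hmin⟩ := hKc.exists_isLeast hne
  refine (measure_mono fun x hx => ?_).trans (hK htK).2
  exact ⟨hmin hx, (hK hx).1.2⟩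

theorem measure_setOf_measure_Icc_le (m : Measure ℝ) [IsFiniteMeasure m] (a b : ℝ) (ε : ℝ≥0∞) :
    m {t | t ∈ Set.Ico a b ∧ m (Set.Icc a t) ≤ ε} ≤ ε := by
  have hmeas : MeasurableSet {t | t ∈ Set.Ico a b ∧ m (Set.Icc a t) ≤ ε} := by
    apply Set.OrdConnected.measurableSet
    refine ⟨fun x hx y hy z hz => ⟨⟨hx.1.1.trans hz.1, hz.2.trans_lt hy.1.2⟩, ?_⟩⟩
    exact (measure_mono (Set.Icc_subset_Icc_right hz.2)).trans hy.2
  rw [hmeas.measure_eq_iSup_isCompact m]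
  refine iSup₂_le fun K hK => iSup_le fun hKc => ?_
  rcases K.eq_empty_or_nonempty with rfl | hne
  · simp
  obtain ⟨t, htK, hmax⟩ := hKc.exists_isGreatest hne
  refine (measure_mono fun x hx => ?_).trans (hK htK).2
  exact ⟨(hK hx).1.1, hmax hx⟩

/-- The set of points that lie in an arc of small measure but not of small diameter is small. -/
theorem measure_setOf_exists_isArc_not_subset_le (ν : Measure UnitAddCircle) [IsFiniteMeasure ν]
    {r : ℝ} {N : ℕ} (hN : 0 < N) (hr : 1 / (N : ℝ) < r) (ε : ℝ≥0∞) :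
    ν {ξ | ∃ J, IsArc J ∧ ξ ∈ J ∧ ¬ J ⊆ Metric.closedBall ξ r ∧ ν J ≤ ε} ≤ N * (2 * ε) := by
  have hN' : (0 : ℝ) < N := by exact_mod_cast hN
  set s : UnitAddCircle → ℝ := fun ξ => (AddCircle.measurableEquivIco 1 0 ξ : ℝ) with hs
  have hsm : Measurable s := measurable_subtype_coe.comp (MeasurableEquiv.measurable _)
  have hs0 : ∀ ξ, s ξ ∈ Set.Ico (0 : ℝ) 1 := fun ξ => by
    simpa using (AddCircle.measurableEquivIco 1 0 ξ).2
  have hsc : ∀ ξ, ((s ξ : ℝ) : UnitAddCircle) = ξ := fun ξ => AddCircle.coe_equivIco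
  set m := ν.map s with hm
  have : IsFiniteMeasure m := Measure.isFiniteMeasure_map ν s
  -- The circle is cut into N cells of length 1/N < r. An arc through ξ that leaves the r-ball must
  -- contain the whole part of the cell of ξ on one side of ξ, since otherwise a missing point on
  -- each side would separate ξ from the far point. That part then has measure at most ε, which puts
  -- ξ in `A i`.
  let A : ℕ → Set ℝ := fun i =>
    {t | t ∈ Set.Ico ((i : ℝ) / N) ((i + 1 : ℝ) / N) ∧ m (Set.Ico t ((i + 1 : ℝ) / N)) ≤ ε} ∪
    {t | t ∈ Set.Ico ((i : ℝ) / N) ((i + 1 : ℝ) / N) ∧ m (Set.Icc ((i : ℝ) / N) t) ≤ ε}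
  have hA : ∀ i, m (A i) ≤ 2 * ε := fun i => by
    rw [two_mul]
    exact (measure_union_le _ _).trans
      (add_le_add (measure_setOf_measure_Ico_le m _ _ ε) (measure_setOf_measure_Icc_le m _ _ ε))
  have hsub : {ξ | ∃ J, IsArc J ∧ ξ ∈ J ∧ ¬ J ⊆ Metric.closedBall ξ r ∧ ν J ≤ ε} ⊆
      s ⁻¹' ⋃ i ∈ Finset.range N, A i := by
    rintro ξ ⟨J, hJ, hξ, hJr, hJε⟩
    obtain ⟨y, hyJ, hy⟩ := Set.not_subset.1 hJr
    obtain ⟨b, hb, rfl⟩ := exists_eq_add_coe ξ y 0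
    rw [Metric.mem_closedBall, not_le, dist_eq_norm, add_sub_cancel_left] at hy
    have hb1 : r < b := by
      have h := hy.trans_le (QuotientAddGroup.norm_mk_le_norm (S := AddSubgroup.zmultiples (1 : ℝ)))
      rwa [Real.norm_eq_abs, abs_of_nonneg hb.1] at h
    have hb2 : r < 1 - b := by
      have e : (b : UnitAddCircle) = ((b - 1 : ℝ) : UnitAddCircle) := by
        rw [AddCircle.coe_sub, AddCircle.coe_period, sub_zero]
      rw [e] at hy
      have h := hy.trans_le (QuotientAddGroup.norm_mk_le_norm (S := AddSubgroup.zmultiples (1 : ℝ)))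
      rwa [Real.norm_eq_abs, abs_sub_comm, abs_of_nonneg (by linarith [hb.2])] at h
    set i := ⌊s ξ * N⌋₊ with hi
    have hi1 : (i : ℝ) / N ≤ s ξ := by
      rw [div_le_iff₀ hN']
      exact Nat.floor_le (mul_nonneg (hs0 ξ).1 hN'.le)
    have hi2 : s ξ < (i + 1 : ℝ) / N := by
      rw [lt_div_iff₀ hN']
      exact Nat.lt_floor_add_one _
    have hlen : (i + 1 : ℝ) / N - (i : ℝ) / N = 1 / N := by ring
    have hiN : i < N := by
      rw [hi, Nat.floor_lt (mul_nonneg (hs0 ξ).1 hN'.le)]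
      nlinarith [(hs0 ξ).2]
    refine Set.mem_iUnion₂.2 ⟨i, Finset.mem_range.2 hiN, ?_⟩
    by_contra hcon
    have hc1 : ¬ m (Set.Ico (s ξ) ((i + 1 : ℝ) / N)) ≤ ε := fun h => hcon (Or.inl ⟨⟨hi1, hi2⟩, h⟩)
    have hc2 : ¬ m (Set.Icc ((i : ℝ) / N) (s ξ)) ≤ ε := fun h => hcon (Or.inr ⟨⟨hi1, hi2⟩, h⟩)
    rw [hm, Measure.map_apply hsm measurableSet_Ico] at hc1
    rw [hm, Measure.map_apply hsm measurableSet_Icc] at hc2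
    have hn1 : ¬ s ⁻¹' (Set.Ico (s ξ) ((i + 1 : ℝ) / N)) ⊆ J :=
      fun h => hc1 ((measure_mono h).trans hJε)
    have hn2 : ¬ s ⁻¹' (Set.Icc ((i : ℝ) / N) (s ξ)) ⊆ J :=
      fun h => hc2 ((measure_mono h).trans hJε)
    obtain ⟨z, hz, hzJ⟩ := Set.not_subset.1 hn1
    obtain ⟨w, hw, hwJ⟩ := Set.not_subset.1 hn2
    simp only [Set.mem_preimage] at hz hw
    have hz' : ξ + ((s z - s ξ : ℝ) : UnitAddCircle) = z := by
      rw [AddCircle.coe_sub, hsc, hsc]; abel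
    have hw' : ξ + ((1 + (s w - s ξ) : ℝ) : UnitAddCircle) = w := by
      rw [AddCircle.coe_add, AddCircle.coe_sub, hsc, hsc, AddCircle.coe_period]; abel
    have hz0 : s z ≠ s ξ := fun h => hzJ (by rw [← hsc z, h, hsc]; exact hξ)
    have hw0 : s w ≠ s ξ := fun h => hwJ (by rw [← hsc w, h, hsc]; exact hξ)
    have hz1 : s ξ < s z := lt_of_le_of_ne hz.1 hz0.symm
    have hw1 : s w < s ξ := lt_of_le_of_ne hw.2 hw0
    rcases mem_or_mem_of_isPreconnected hJ.2 (a := s z - s ξ) (b := b) (c := 1 + (s w - s ξ))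
      (by linarith) (by linarith [hz.2]) (by linarith [hw.1]) (by linarith) hξ hyJ with h | h
    · exact hzJ (hz' ▸ h)
    · exact hwJ (hw' ▸ h)
  calc _ ≤ ν (s ⁻¹' ⋃ i ∈ Finset.range N, A i) := measure_mono hsub
    _ ≤ m (⋃ i ∈ Finset.range N, A i) := Measure.le_map_apply hsm.aemeasurable _
    _ ≤ ∑ i ∈ Finset.range N, m (A i) := measure_biUnion_finset_le _ _
    _ ≤ ∑ i ∈ Finset.range N, 2 * ε := Finset.sum_le_sum fun i _ => hA i
    _ = N * (2 * ε) := by simp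

/-- Smallness of arcs is measured by ν, so differentiation needs arcs of small measure to shrink to
the point. For a fixed radius the exceptional set has measure O(1/n) for every n, hence is null. -/
theorem ae_exists_forall_isArc_subset (ν : Measure UnitAddCircle) [IsFiniteMeasure ν] :
    ∀ᵐ ξ ∂ν, ∀ O ∈ 𝓝 ξ, ∃ n : ℕ, ∀ J, IsArc J → ξ ∈ J → ν J < (n : ℝ≥0∞)⁻¹ → J ⊆ O := by
  have key : ∀ᵐ ξ ∂ν, ∀ k : ℕ, ∃ n : ℕ, ∀ J, IsArc J → ξ ∈ J → ν J < (n : ℝ≥0∞)⁻¹ →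
      J ⊆ Metric.closedBall ξ (1 / ((k : ℝ) + 1)) := by
    refine ae_all_iff.2 fun k => ?_
    rw [ae_iff]
    have hr : 1 / ((k + 2 : ℕ) : ℝ) < 1 / ((k : ℝ) + 1) := by
      push_cast
      gcongr
      norm_num
    have hlim : Tendsto (fun n : ℕ => ((k + 2 : ℕ) : ℝ≥0∞) * (2 * (n : ℝ≥0∞)⁻¹)) atTop (𝓝 0) := by
      have h1 := ENNReal.Tendsto.const_mul (a := 2) ENNReal.tendsto_inv_nat_nhds_zero (Or.inr (by simp))
      have h2 := ENNReal.Tendsto.const_mul (a := ((k + 2 : ℕ) : ℝ≥0∞)) h1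
        (Or.inr (ENNReal.natCast_ne_top _))
      simpa using h2
    refine le_antisymm (ge_of_tendsto' hlim fun n => ?_) bot_le
    refine (measure_mono ?_).trans
      (measure_setOf_exists_isArc_not_subset_le ν (Nat.succ_pos _) hr (n : ℝ≥0∞)⁻¹)
    intro ξ hξ
    simp only [Set.mem_ofPred_eq, not_exists, not_forall] at hξ
    obtain ⟨J, h1, h2, h3, h4⟩ := hξ n
    exact ⟨J, h1, h2, h4, h3.le⟩
  filter_upwards [key] with ξ hξ O hO
  obtain ⟨r, hr, hrO⟩ := Metric.nhds_basis_closedBall.mem_iff.1 hO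
  obtain ⟨k, hk⟩ := exists_nat_one_div_lt hr
  obtain ⟨n, hn⟩ := hξ k
  exact ⟨n, fun J h1 h2 h3 =>
    (hn J h1 h2 h3).trans ((Metric.closedBall_subset_closedBall hk.le).trans hrO)⟩

/-- Differentiation of measures along arcs, upper bound. -/
theorem ae_exists_forall_isArc_measure_le (ν ρ : Measure UnitAddCircle) [IsFiniteMeasure ν]
    [IsFiniteMeasure ρ] {t s : ℝ≥0∞} (hts : t < s) :
    ∀ᵐ ξ ∂ν, ρ.rnDeriv ν ξ < t →
      ∃ n : ℕ, ∀ J, IsArc J → ξ ∈ J → ν J < (n : ℝ≥0∞)⁻¹ → ρ J ≤ s * ν J := by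
  set q := ρ.rnDeriv ν with hq
  obtain ⟨N, hN, hN0, hNc⟩ := Measure.mutuallySingular_singularPart ρ ν
  -- On `A` the measure ρ is at most tν, so an arc with ρ J > s ν J has mass at least (s − t) ν J
  -- for the restriction ρ' of ρ to the complement of `A`. As ρ' A = 0, the arcs can be kept in an
  -- open set of arbitrarily small ρ'-mass, and the weak type inequality makes the bad set null.
  set A : Set UnitAddCircle := {ξ | q ξ < t} ∩ N with hA
  have hAm : MeasurableSet A :=
    (measurableSet_lt (Measure.measurable_rnDeriv ρ ν) measurable_const).inter hN
  have hρA : ∀ J, MeasurableSet J → ρ (J ∩ A) ≤ t * ν J := by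
    intro J hJ
    have h1 : ρ (J ∩ A) = ∫⁻ ξ in J ∩ A, q ξ ∂ν := by
      have := Measure.haveLebesgueDecomposition_of_sigmaFinite ρ ν
      conv_lhs => rw [Measure.haveLebesgueDecomposition_add ρ ν]
      rw [Measure.add_apply, withDensity_apply _ (hJ.inter hAm),
        measure_mono_null (Set.inter_subset_right.trans Set.inter_subset_right) hN0, zero_add]
    rw [h1]
    calc ∫⁻ ξ in J ∩ A, q ξ ∂ν ≤ ∫⁻ ξ in J ∩ A, t ∂ν :=
          setLIntegral_mono measurable_const fun ξ hξ => hξ.2.1.le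
      _ = t * ν (J ∩ A) := setLIntegral_const _ _
      _ ≤ t * ν J := by gcongr; exact Set.inter_subset_left
  set ρ' := ρ.restrict Aᶜ with hρ'
  have hρ'A : ρ' A = 0 := by rw [hρ', Measure.restrict_apply hAm]; simp
  set bad : Set UnitAddCircle := {ξ | ξ ∈ A ∧ (∀ O ∈ 𝓝 ξ, ∃ n : ℕ, ∀ J, IsArc J → ξ ∈ J →
      ν J < (n : ℝ≥0∞)⁻¹ → J ⊆ O) ∧
      ∀ n : ℕ, ∃ J, IsArc J ∧ ξ ∈ J ∧ ν J < (n : ℝ≥0∞)⁻¹ ∧ s * ν J < ρ J} with hbad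
  have hu : s - t ≠ 0 := (tsub_pos_of_lt hts).ne'
  have hbad0 : ν bad = 0 := by
    have h1 : ∀ ε : ℝ≥0∞, 0 < ε → (s - t) * ν bad ≤ 2 * ε := by
      intro ε hε
      obtain ⟨O, hAO, hO, hOε⟩ := A.exists_isOpen_lt_of_lt ε (hρ'A.trans_lt hε)
      set 𝒥 : Set (Set UnitAddCircle) := {J | IsArc J ∧ J ⊆ O ∧ (s - t) * ν J ≤ ρ' J} with h𝒥
      have hsub : bad ⊆ ⋃₀ 𝒥 := by
        rintro ξ ⟨hξA, hesc, hξ⟩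
        obtain ⟨n, hn⟩ := hesc O (hO.mem_nhds (hAO hξA))
        obtain ⟨J, hJ, hξJ, hJn, hJs⟩ := hξ n
        refine ⟨J, ⟨hJ, hn J hJ hξJ hJn, ?_⟩, hξJ⟩
        have h2 : ρ J ≤ t * ν J + ρ' J := by
          rw [hρ', Measure.restrict_apply hJ.1.measurableSet, ← measure_inter_add_sdiff J hAm]
          exact add_le_add (hρA J hJ.1.measurableSet) le_rfl
        rw [ENNReal.sub_mul (fun _ _ => measure_ne_top ν J)]
        exact tsub_le_iff_left.2 (hJs.le.trans h2)
      calc (s - t) * ν bad ≤ (s - t) * ν (⋃₀ 𝒥) := by gcongr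
        _ ≤ 2 * ρ' (⋃₀ 𝒥) :=
          mul_measure_sUnion_le_of_isArc ν ρ' (s - t) fun J hJ => ⟨hJ.1, hJ.2.2⟩
        _ ≤ 2 * ε := by
          gcongr
          exact (measure_mono (Set.sUnion_subset fun J hJ => hJ.2.1)).trans hOε.le
    have h2 : (s - t) * ν bad ≤ 0 := by
      refine ENNReal.le_of_forall_pos_le_add fun ε hε _ => ?_
      rw [zero_add]
      have := h1 (ε / 2) (ENNReal.half_pos (by simpa using hε.ne'))
      rwa [ENNReal.mul_div_cancel (by simp) (by simp)] at this
    exact (mul_eq_zero.1 (le_antisymm h2 bot_le)).resolve_left hu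
  have hNae : ∀ᵐ ξ ∂ν, ξ ∈ N := by rw [ae_iff]; exact hNc
  have hbadae : ∀ᵐ ξ ∂ν, ξ ∉ bad := measure_eq_zero_iff_ae_notMem.1 hbad0
  filter_upwards [hNae, hbadae, ae_exists_forall_isArc_subset ν] with ξ h1 h2 h3 h4
  by_contra! hcon
  exact h2 ⟨⟨h4, h1⟩, h3, hcon⟩

/-! ### Joint measurability, the density of the pulled back measure and the maximal ratio. -/

/-- Makes the product σ-algebra on homeomorphisms times circle the Borel one, so that continuous and
semicontinuous functions of (T, ξ) are measurable. -/
instance : SecondCountableTopology CircleHomeo :=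
  TopologicalSpace.secondCountableTopology_induced _ _
    (fun T : CircleHomeo => (T : C(UnitAddCircle, UnitAddCircle)))

theorem continuous_toContinuousMap :
    Continuous (fun T : CircleHomeo => (T : C(UnitAddCircle, UnitAddCircle))) :=
  continuous_induced_dom

/-- With z = T⁻¹y, the points T₀z and Tz = y are uniformly close; uniform continuity of T₀⁻¹ then
brings z close to T₀⁻¹y. -/
theorem continuous_symm_toContinuousMap :
    Continuous (fun T : CircleHomeo => (T.symm : C(UnitAddCircle, UnitAddCircle))) := by
  rw [continuous_iff_continuousAt]
  intro T₀
  rw [ContinuousAt, Metric.tendsto_nhds]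
  intro ε hε
  obtain ⟨δ, hδ, hT⟩ := Metric.uniformContinuous_iff.1
    (CompactSpace.uniformContinuous_of_continuous T₀.symm.continuous) ε hε
  have h := (continuous_toContinuousMap.tendsto T₀).eventually (Metric.ball_mem_nhds _ hδ)
  filter_upwards [h] with T hT'
  rw [ContinuousMap.dist_lt_iff hε]
  intro y
  have h1 := hT (a := T₀ (T.symm y)) (b := T (T.symm y)) (by
    rw [dist_comm]
    exact (ContinuousMap.dist_apply_le_dist (f := (T : C(UnitAddCircle, UnitAddCircle)))
      (g := (T₀ : C(UnitAddCircle, UnitAddCircle))) (T.symm y)).trans_lt hT')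
  simpa using h1

theorem continuous_uncurry_apply : Continuous (fun p : CircleHomeo × UnitAddCircle => p.1 p.2) :=
  (continuous_toContinuousMap.comp continuous_fst).eval continuous_snd

theorem continuous_uncurry_symm_apply :
    Continuous (fun p : CircleHomeo × UnitAddCircle => p.1.symm p.2) :=
  (continuous_symm_toContinuousMap.comp continuous_fst).eval continuous_snd

/-- The measures `J ↦ ν (T J)`, as a kernel in `T`. -/
noncomputable def pullbackKernel (ν : Measure UnitAddCircle) [IsFiniteMeasure ν] :
    ProbabilityTheory.Kernel CircleHomeo UnitAddCircle where
  toFun T := ν.map T.symm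
  measurable' := by
    refine Measure.measurable_of_measurable_coe _ fun B hB => ?_
    have h : MeasurableSet ((fun p : CircleHomeo × UnitAddCircle => p.1.symm p.2) ⁻¹' B) :=
      continuous_uncurry_symm_apply.measurable hB
    have h2 := measurable_measure_prodMk_left (ν := ν) h
    convert h2 using 2 with T
    rw [Measure.map_apply T.symm.measurable hB]
    rfl

instance (ν : Measure UnitAddCircle) [IsProbabilityMeasure ν] :
    ProbabilityTheory.IsMarkovKernel (pullbackKernel ν) :=
  ⟨fun T => Measure.isProbabilityMeasure_map T.symm.measurable.aemeasurable⟩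

theorem map_symm_apply (ν : Measure UnitAddCircle) (T : CircleHomeo) {J : Set UnitAddCircle}
    (hJ : MeasurableSet J) : ν.map T.symm J = ν (T '' J) := by
  rw [Measure.map_apply T.symm.measurable hJ, T.image_eq_preimage_symm]

/-- A jointly measurable version of the density of `J ↦ ν (T J)` with respect to `ν`. -/
noncomputable def pullbackDensity (ν : Measure UnitAddCircle) [IsFiniteMeasure ν]
    (p : CircleHomeo × UnitAddCircle) : ℝ≥0∞ :=
  (pullbackKernel ν).rnDeriv (ProbabilityTheory.Kernel.const _ ν) p.1 p.2

theorem measurable_pullbackDensity (ν : Measure UnitAddCircle) [IsFiniteMeasure ν] :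
    Measurable (pullbackDensity ν) :=
  ProbabilityTheory.Kernel.measurable_rnDeriv _ _

theorem pullbackDensity_ae_eq (ν : Measure UnitAddCircle) [IsProbabilityMeasure ν]
    (T : CircleHomeo) :
    (fun ξ => pullbackDensity ν (T, ξ)) =ᵐ[ν] (ν.map T.symm).rnDeriv ν :=
  ProbabilityTheory.Kernel.rnDeriv_eq_rnDeriv_measure
    (κ := pullbackKernel ν) (η := ProbabilityTheory.Kernel.const _ ν) (a := T)

theorem lintegral_pullbackDensity_le (ν : Measure UnitAddCircle) [IsProbabilityMeasure ν]
    (T : CircleHomeo) : ∫⁻ ξ, pullbackDensity ν (T, ξ) ∂ν ≤ 1 := by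
  have : IsProbabilityMeasure (ν.map T.symm) :=
    Measure.isProbabilityMeasure_map T.symm.measurable.aemeasurable
  rw [lintegral_congr_ae (pullbackDensity_ae_eq ν T)]
  exact Measure.lintegral_rnDeriv_le.trans_eq measure_univ

/-- The maximal function of `J ↦ ν (T J)` with respect to `ν`, over arcs of measure less than
`1 / n`. -/
noncomputable def maxRatio (ν : Measure UnitAddCircle) (n : ℕ) (p : CircleHomeo × UnitAddCircle) :
    ℝ≥0∞ :=
  ⨆ (J : Set UnitAddCircle) (_ : IsArc J ∧ p.2 ∈ J ∧ ν J < (n : ℝ≥0∞)⁻¹), ν (p.1 '' J) / ν J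

theorem lt_maxRatio_iff {ν : Measure UnitAddCircle} {n : ℕ} {p : CircleHomeo × UnitAddCircle}
    {c : ℝ≥0∞} : c < maxRatio ν n p ↔
      ∃ J, (IsArc J ∧ p.2 ∈ J ∧ ν J < (n : ℝ≥0∞)⁻¹) ∧ c < ν (p.1 '' J) / ν J := by
  simp only [maxRatio, lt_iSup_iff, exists_prop]

/-- The supremum runs over uncountably many arcs, so measurability has to come from semicontinuity.
If J witnesses a ratio above c at (T, ξ), so does a compact K ⊆ TJ in place of TJ, and both K ⊆ T'J
and ξ' ∈ J are open conditions. -/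
theorem lowerSemicontinuous_maxRatio (ν : Measure UnitAddCircle) [IsFiniteMeasure ν] (n : ℕ) :
    LowerSemicontinuous (maxRatio ν n) := by
  intro p c hc
  obtain ⟨J, ⟨hJ, hpJ, hJn⟩, hcJ⟩ := lt_maxRatio_iff.1 hc
  have hK : ∃ K ⊆ p.1 '' J, IsCompact K ∧ c < ν K / ν J := by
    rw [(hJ.image p.1).1.measure_eq_iSup_isCompact ν, div_eq_mul_inv] at hcJ
    simp only [ENNReal.iSup_mul, lt_iSup_iff, exists_prop] at hcJ
    obtain ⟨K, h1, h2, h3⟩ := hcJ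
    exact ⟨K, h1, h2, by rwa [div_eq_mul_inv]⟩
  obtain ⟨K, hKJ, hKc, hcK⟩ := hK
  have h1 : ∀ᶠ T : CircleHomeo in 𝓝 p.1, Set.MapsTo T.symm K J := by
    have ho := (ContinuousMap.isOpen_setOfPred_mapsTo (X := UnitAddCircle) hKc hJ.1).preimage
      continuous_symm_toContinuousMap
    refine ho.mem_nhds ?_
    intro y hy
    obtain ⟨x, hx, rfl⟩ := hKJ hy
    simpa using hx
  have h2 : ∀ᶠ ξ in 𝓝 p.2, ξ ∈ J := hJ.1.mem_nhds hpJ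
  rw [show 𝓝 p = 𝓝 p.1 ×ˢ 𝓝 p.2 from nhds_prod_eq]
  filter_upwards [h1.prod_mk h2] with p' hp'
  refine lt_maxRatio_iff.2 ⟨J, ⟨hJ, hp'.2, hJn⟩, hcK.trans_le ?_⟩
  gcongr
  intro y hy
  exact ⟨p'.1.symm y, hp'.1 hy, by simp⟩

theorem measurable_maxRatio (ν : Measure UnitAddCircle) [IsFiniteMeasure ν] (n : ℕ) :
    Measurable (maxRatio ν n) :=
  (lowerSemicontinuous_maxRatio ν n).measurable

theorem maxRatio_anti (ν : Measure UnitAddCircle) {m n : ℕ} (h : m ≤ n)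
    (p : CircleHomeo × UnitAddCircle) : maxRatio ν n p ≤ maxRatio ν m p := by
  refine biSup_mono fun J hJ => ⟨hJ.1, hJ.2.1, hJ.2.2.trans_le ?_⟩
  gcongr

/-- Finiteness of the maximal ratio excludes null arcs with non-null image, whose ratio is ∞. -/
theorem measure_image_le_maxRatio_mul (ν : Measure UnitAddCircle) [IsFiniteMeasure ν] {n : ℕ}
    {p : CircleHomeo × UnitAddCircle} (hp : maxRatio ν n p ≠ ∞) {J : Set UnitAddCircle}
    (hJ : IsArc J) (hpJ : p.2 ∈ J) (hJn : ν J < (n : ℝ≥0∞)⁻¹) :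
    ν (p.1 '' J) ≤ maxRatio ν n p * ν J := by
  rw [← ENNReal.div_le_iff_le_mul (Or.inr hp) (Or.inl (measure_ne_top ν J))]
  exact le_iSup₂_of_le J ⟨hJ, hpJ, hJn⟩ le_rfl

theorem mul_measure_lt_maxRatio_le (ν : Measure UnitAddCircle) [IsProbabilityMeasure ν] (n : ℕ)
    (T : CircleHomeo) (l : ℝ≥0∞) : l * ν {ξ | l < maxRatio ν n (T, ξ)} ≤ 2 := by
  have : IsProbabilityMeasure (ν.map T.symm) :=
    Measure.isProbabilityMeasure_map T.symm.measurable.aemeasurable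
  have h := mul_measure_sUnion_le_of_isArc ν (ν.map T.symm) l
    (𝒥 := {J | IsArc J ∧ l * ν J ≤ ν.map T.symm J}) fun J hJ => hJ
  calc _ ≤ l * ν (⋃₀ {J | IsArc J ∧ l * ν J ≤ ν.map T.symm J}) := by
        gcongr
        intro ξ hξ
        obtain ⟨J, ⟨h1, h2, -⟩, h3⟩ := lt_maxRatio_iff.1 hξ
        refine ⟨J, ⟨h1, ?_⟩, h2⟩
        rw [map_symm_apply ν T h1.1.measurableSet]
        exact ENNReal.mul_le_of_le_div h3.le
    _ ≤ 2 * ν.map T.symm (⋃₀ {J | IsArc J ∧ l * ν J ≤ ν.map T.symm J}) := h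
    _ ≤ 2 * 1 := by gcongr; exact prob_le_one
    _ = 2 := mul_one _

/-- Differentiation of J ↦ ν(TJ) along arcs, for all pairs of rational thresholds at once so that
only countably many null sets are discarded. -/
theorem ae_iInf_maxRatio_le (ν : Measure UnitAddCircle) [IsProbabilityMeasure ν]
    (T : CircleHomeo) : ∀ᵐ ξ ∂ν, ⨅ n, maxRatio ν n (T, ξ) ≤ pullbackDensity ν (T, ξ) := by
  have : IsProbabilityMeasure (ν.map T.symm) :=
    Measure.isProbabilityMeasure_map T.symm.measurable.aemeasurable
  have h : ∀ᵐ ξ ∂ν, ∀ a b : ℚ, ((Real.toNNReal a : NNReal) : ℝ≥0∞) < (Real.toNNReal b : NNReal) →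
      (ν.map T.symm).rnDeriv ν ξ < (Real.toNNReal a : NNReal) →
      ∃ n : ℕ, ∀ J, IsArc J → ξ ∈ J → ν J < (n : ℝ≥0∞)⁻¹ →
        ν.map T.symm J ≤ (Real.toNNReal b : NNReal) * ν J := by
    refine ae_all_iff.2 fun a => ae_all_iff.2 fun b => ?_
    by_cases hab : ((Real.toNNReal a : NNReal) : ℝ≥0∞) < (Real.toNNReal b : NNReal)
    · filter_upwards [ae_exists_forall_isArc_measure_le ν (ν.map T.symm) hab] with ξ hξ _
      exact hξ
    · exact Eventually.of_forall fun ξ h => absurd h hab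
  filter_upwards [h, pullbackDensity_ae_eq ν T] with ξ hξ hq
  rw [hq]
  by_contra! hcon
  obtain ⟨b, -, hb1, hb2⟩ := ENNReal.lt_iff_exists_rat_btwn.1 hcon
  obtain ⟨a, -, ha1, ha2⟩ := ENNReal.lt_iff_exists_rat_btwn.1 hb1
  obtain ⟨n, hn⟩ := hξ a b ha2 ha1
  refine absurd hb2 (not_lt.2 ((iInf_le _ n).trans (iSup₂_le fun J hJ => ?_)))
  refine ENNReal.div_le_of_le_mul ?_
  rw [← map_symm_apply ν T hJ.1.1.measurableSet]
  exact hn J hJ.1 hJ.2.1 hJ.2.2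

theorem ae_prod_iInf_maxRatio_le (μ : Measure CircleHomeo) [IsProbabilityMeasure μ]
    (ν : Measure UnitAddCircle) [IsProbabilityMeasure ν] :
    ∀ᵐ p ∂μ.prod ν, ⨅ n, maxRatio ν n p ≤ pullbackDensity ν p := by
  rw [Measure.ae_prod_iff_ae_ae (measurableSet_le
    (Measurable.iInf fun n => measurable_maxRatio ν n) (measurable_pullbackDensity ν))]
  exact Eventually.of_forall fun T => ae_iInf_maxRatio_le ν T

theorem mul_prod_measure_lt_maxRatio_le (μ : Measure CircleHomeo) [IsProbabilityMeasure μ]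
    (ν : Measure UnitAddCircle) [IsProbabilityMeasure ν] (n : ℕ) (l : ℝ≥0∞) :
    l * μ.prod ν {p | l < maxRatio ν n p} ≤ 2 := by
  have hm : MeasurableSet {p | l < maxRatio ν n p} :=
    measurableSet_lt measurable_const (measurable_maxRatio ν n)
  rw [Measure.prod_apply hm, ← lintegral_const_mul _ (measurable_measure_prodMk_left hm)]
  calc _ ≤ ∫⁻ _ : CircleHomeo, 2 ∂μ :=
        lintegral_mono fun T => mul_measure_lt_maxRatio_le ν n T l
    _ = 2 := by simp

theorem IsStationary.measurePreserving {μ : Measure CircleHomeo} [IsProbabilityMeasure μ]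
    {ν : Measure UnitAddCircle} [IsProbabilityMeasure ν] (hν : IsStationary μ ν) :
    MeasurePreserving (fun p : CircleHomeo × UnitAddCircle => p.1 p.2) (μ.prod ν) ν := by
  have hm : Measurable (fun p : CircleHomeo × UnitAddCircle => p.1 p.2) :=
    continuous_uncurry_apply.measurable
  refine ⟨hm, Measure.ext fun A hA => ?_⟩
  rw [Measure.map_apply hm hA, Measure.prod_apply (hm hA), hν A hA]
  refine lintegral_congr fun T => ?_
  rw [Measure.map_apply T.measurable hA]
  rfl

/-! ### A lower-growth form of the ergodic theorem. -/

section Ergodic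

variable {Ω : Type*}

/-- The maximum of `0` and the first `N` Birkhoff sums, defined recursively. -/
def birkhoffMax (F : Ω → Ω) (g : Ω → ℝ) : ℕ → Ω → ℝ
  | 0, _ => 0
  | N + 1, ω => max 0 (g ω + birkhoffMax F g N (F ω))

theorem birkhoffMax_nonneg (F : Ω → Ω) (g : Ω → ℝ) (N : ℕ) (ω : Ω) : 0 ≤ birkhoffMax F g N ω := by
  cases N with
  | zero => exact le_rfl
  | succ N => exact le_max_left _ _

theorem birkhoffMax_le_succ (F : Ω → Ω) (g : Ω → ℝ) (N : ℕ) (ω : Ω) :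
    birkhoffMax F g N ω ≤ birkhoffMax F g (N + 1) ω := by
  induction N generalizing ω with
  | zero => exact birkhoffMax_nonneg F g 1 ω
  | succ N ih => exact max_le_max le_rfl (by linarith [ih (F ω)])

theorem birkhoffSum_le_birkhoffMax (F : Ω → Ω) (g : Ω → ℝ) (N : ℕ) (ω : Ω) :
    birkhoffSum F g N ω ≤ birkhoffMax F g N ω := by
  induction N generalizing ω with
  | zero => simp [birkhoffMax]
  | succ N ih =>
    rw [birkhoffSum_succ']
    exact (by linarith [ih (F ω)] : _ ≤ g ω + birkhoffMax F g N (F ω)).trans (le_max_right _ _)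

/-- The largest rate of linear growth that bounds all Birkhoff sums from below, up to a
constant. -/
noncomputable def lowerRate (F : Ω → Ω) (g : Ω → ℝ) (ω : Ω) : ℝ≥0∞ :=
  ⨆ (c : ℚ) (_ : ∃ C : ℕ, ∀ n : ℕ, (c : ℝ) * n - C ≤ birkhoffSum F g n ω), ENNReal.ofReal c

theorem lowerRate_apply_map (F : Ω → Ω) (g : Ω → ℝ) (ω : Ω) :
    lowerRate F g (F ω) = lowerRate F g ω := by
  refine iSup_congr fun c => ?_
  refine iSup_congr_Prop ⟨?_, ?_⟩ fun _ => rfl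
  · rintro ⟨C, hC⟩
    obtain ⟨C', hC'⟩ := exists_nat_ge (max 0 (C + c - g ω))
    refine ⟨C', fun n => ?_⟩
    cases n with
    | zero => simp
    | succ n =>
      rw [birkhoffSum_succ']
      have := hC n
      have := (le_max_right _ _).trans hC'
      push_cast
      linarith
  · rintro ⟨C, hC⟩
    obtain ⟨C', hC'⟩ := exists_nat_ge (C - c + g ω)
    refine ⟨C', fun n => ?_⟩
    have := hC (n + 1)
    rw [birkhoffSum_succ'] at this
    push_cast at this
    linarith

theorem lowerRate_le {F : Ω → Ω} {g : Ω → ℝ} {K : ℝ} (hK : ∀ ω, g ω ≤ K) (ω : Ω) :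
    lowerRate F g ω ≤ ENNReal.ofReal K := by
  refine iSup₂_le fun c hc => ENNReal.ofReal_le_ofReal ?_
  obtain ⟨C, hC⟩ := hc
  have h1 : ∀ n : ℕ, birkhoffSum F g n ω ≤ n * K := fun n => by
    refine (Finset.sum_le_sum fun k _ => hK _).trans ?_
    simp
  by_contra! hcon
  obtain ⟨n, hn⟩ := exists_nat_gt (C / (c - K) : ℝ)
  rw [div_lt_iff₀ (by linarith)] at hn
  have := hC n
  have := h1 n
  linarith

variable [MeasurableSpace Ω] {P : Measure Ω}

theorem measurable_birkhoffMax {F : Ω → Ω} (hF : Measurable F) {g : Ω → ℝ} (hg : Measurable g)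
    (N : ℕ) : Measurable (birkhoffMax F g N) := by
  induction N with
  | zero => exact measurable_const
  | succ N ih => exact measurable_const.max (hg.add (ih.comp hF))

theorem integrable_birkhoffMax {F : Ω → Ω} (hF : MeasurePreserving F P P) {g : Ω → ℝ}
    (hg : Integrable g P) (N : ℕ) : Integrable (birkhoffMax F g N) P := by
  induction N with
  | zero => exact integrable_zero _ _ _
  | succ N ih => exact (integrable_zero _ _ _).sup (hg.add (hF.integrable_comp_of_integrable ih))

/-- The maximal ergodic theorem, when almost every orbit has a positive Birkhoff sum. -/
theorem integral_nonneg_of_forall_exists_birkhoffSum_pos {F : Ω → Ω}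
    (hF : MeasurePreserving F P P) {g : Ω → ℝ} (hgm : Measurable g) (hg : Integrable g P)
    (h : ∀ ω, ∃ n, 0 < birkhoffSum F g n ω) : 0 ≤ ∫ ω, g ω ∂P := by
  have hpos : ∀ N, MeasurableSet {ω | 0 < birkhoffMax F g N ω} := fun N =>
    measurableSet_lt measurable_const (measurable_birkhoffMax hF.measurable hgm N)
  have h1 : ∀ N, 0 ≤ ∫ ω, {ω | 0 < birkhoffMax F g N ω}.indicator g ω ∂P := by
    intro N
    have hM := integrable_birkhoffMax hF hg N
    have h2 : ∫ ω, birkhoffMax F g N ω - birkhoffMax F g N (F ω) ∂P = 0 := by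
      have h4 := integral_sub hM (hF.integrable_comp_of_integrable hM)
      simp only [Function.comp_apply] at h4
      rw [h4, sub_eq_zero]
      have h3 := integral_map hF.measurable.aemeasurable (μ := P) (f := birkhoffMax F g N)
        (by rw [hF.map_eq]; exact hM.1)
      rw [hF.map_eq] at h3
      exact h3
    -- Garsia's argument: where the maximum M_N is positive, M_N ≤ g + M_N ∘ F; elsewhere M_N = 0 ≤
    -- M_N ∘ F.
    refine h2.ge.trans ?_
    refine integral_mono (hM.sub (hF.integrable_comp_of_integrable hM)) (hg.indicator (hpos N))
      fun ω => ?_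
    by_cases hω : 0 < birkhoffMax F g N ω
    · rw [Set.indicator_of_mem (show ω ∈ {ω | 0 < birkhoffMax F g N ω} from hω)]
      cases N with
      | zero => exact absurd hω (lt_irrefl _)
      | succ N =>
        have h4 : birkhoffMax F g (N + 1) ω = g ω + birkhoffMax F g N (F ω) := by
          rcases max_choice 0 (g ω + birkhoffMax F g N (F ω)) with h5 | h5
          · exact absurd hω (by rw [birkhoffMax, h5]; exact lt_irrefl _)
          · rw [birkhoffMax, h5]
        linarith [birkhoffMax_le_succ F g N (F ω)]
    · rw [Set.indicator_of_notMem (show ω ∉ {ω | 0 < birkhoffMax F g N ω} from hω)]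
      linarith [birkhoffMax_nonneg F g N (F ω)]
  have h2 : Tendsto (fun N => ∫ ω, {ω | 0 < birkhoffMax F g N ω}.indicator g ω ∂P) atTop
      (𝓝 (∫ ω, g ω ∂P)) := by
    refine tendsto_integral_of_dominated_convergence (fun ω => ‖g ω‖)
      (fun N => (hg.indicator (hpos N)).1) hg.norm
      (fun N => Eventually.of_forall fun ω => norm_indicator_le_norm_self _ _)
      (Eventually.of_forall fun ω => ?_)
    obtain ⟨n, hn⟩ := h ω
    refine tendsto_const_nhds.congr' ?_
    filter_upwards [eventually_ge_atTop n] with N hN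
    have hmono : Monotone fun N => birkhoffMax F g N ω :=
      monotone_nat_of_le_succ fun N => birkhoffMax_le_succ F g N ω
    exact (Set.indicator_of_mem (show ω ∈ {ω | 0 < birkhoffMax F g N ω} from
      hn.trans_le ((birkhoffSum_le_birkhoffMax F g n ω).trans (hmono hN))) g).symm
  exact ge_of_tendsto' h2 h1

theorem measurable_birkhoffSum {F : Ω → Ω} (hF : Measurable F) {g : Ω → ℝ} (hg : Measurable g)
    (n : ℕ) : Measurable (birkhoffSum F g n) :=
  Finset.measurable_sum _ fun k _ => hg.comp (hF.iterate k)

theorem measurable_lowerRate {F : Ω → Ω} (hF : Measurable F) {g : Ω → ℝ} (hg : Measurable g) :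
    Measurable (lowerRate F g) := by
  refine Measurable.iSup fun c => ?_
  classical
  have h : MeasurableSet {ω | ∃ C : ℕ, ∀ n : ℕ, (c : ℝ) * n - C ≤ birkhoffSum F g n ω} := by
    have : {ω | ∃ C : ℕ, ∀ n : ℕ, (c : ℝ) * n - C ≤ birkhoffSum F g n ω} =
        ⋃ C : ℕ, ⋂ n : ℕ, {ω | (c : ℝ) * n - C ≤ birkhoffSum F g n ω} := by
      ext ω; simp
    rw [this]
    exact MeasurableSet.iUnion fun C => MeasurableSet.iInter fun n =>
      measurableSet_le measurable_const (measurable_birkhoffSum hF hg n)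
  have h2 : Measurable ({ω | ∃ C : ℕ, ∀ n : ℕ, (c : ℝ) * n - C ≤ birkhoffSum F g n ω}.indicator
      fun _ => ENNReal.ofReal (c : ℝ)) := measurable_const.indicator h
  convert h2 using 2 with ω
  by_cases hω : ∃ C : ℕ, ∀ n : ℕ, (c : ℝ) * n - C ≤ birkhoffSum F g n ω
  · rw [Set.indicator_of_mem (by exact hω)]
    exact iSup_pos hω
  · rw [Set.indicator_of_notMem (by exact hω)]
    exact iSup_neg hω

/-- The integral of a function bounded above is at most the integral of the lower rate of growth
of its Birkhoff sums. -/
theorem ofReal_integral_le_lintegral_lowerRate [IsProbabilityMeasure P] {F : Ω → Ω}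
    (hF : MeasurePreserving F P P) {g : Ω → ℝ} (hgm : Measurable g) (hg : Integrable g P) {K : ℝ}
    (hK : ∀ ω, g ω ≤ K) : ENNReal.ofReal (∫ ω, g ω ∂P) ≤ ∫⁻ ω, lowerRate F g ω ∂P := by
  set w : Ω → ℝ := fun ω => (lowerRate F g ω).toReal with hw
  have hfin : ∀ ω, lowerRate F g ω ≠ ∞ := fun ω =>
    ne_top_of_le_ne_top ENNReal.ofReal_ne_top (lowerRate_le hK ω)
  have hwm : Measurable w := (measurable_lowerRate hF.measurable hgm).ennreal_toReal
  have hwi : Integrable w P := by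
    refine Integrable.of_bound hwm.aestronglyMeasurable (max K 0)
      (Eventually.of_forall fun ω => ?_)
    rw [Real.norm_eq_abs, abs_of_nonneg ENNReal.toReal_nonneg]
    have := ENNReal.toReal_mono ENNReal.ofReal_ne_top (lowerRate_le (F := F) hK ω)
    rwa [ENNReal.toReal_ofReal'] at this
  have hlin : ∫⁻ ω, lowerRate F g ω ∂P = ENNReal.ofReal (∫ ω, w ω ∂P) := by
    rw [ofReal_integral_eq_lintegral_ofReal hwi
      (Eventually.of_forall fun ω => ENNReal.toReal_nonneg)]
    exact lintegral_congr fun ω => (ENNReal.ofReal_toReal (hfin ω)).symm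
  rw [hlin]
  refine ENNReal.ofReal_le_ofReal (le_of_forall_pos_le_add fun ε hε => ?_)
  have hinv : ∀ k ω, w (F^[k] ω) = w ω := by
    intro k
    induction k with
    | zero => intro ω; rfl
    | succ k ih =>
      intro ω
      rw [Function.iterate_succ_apply, ih, hw]
      simp only [lowerRate_apply_map]
  have hint : Integrable (fun ω => w ω + ε - g ω) P := (hwi.add (integrable_const ε)).sub hg
  -- Since w is invariant, if no Birkhoff sum of w + ε − g were positive, those of g would be at
  -- least n(w + ε), and a rational strictly between w and w + ε would be an admissible rate
  -- exceeding the supremum w.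
  have key := integral_nonneg_of_forall_exists_birkhoffSum_pos hF (g := fun ω => w ω + ε - g ω)
    ((hwm.add_const ε).sub hgm) hint (by
      intro ω
      by_contra! hcon
      have hS : ∀ n : ℕ, birkhoffSum F (fun ω => w ω + ε - g ω) n ω
          = n * (w ω + ε) - birkhoffSum F g n ω := by
        intro n
        simp [birkhoffSum, hinv, Finset.sum_sub_distrib, mul_add]
      obtain ⟨c, hc1, hc2⟩ := exists_rat_btwn (lt_add_of_pos_right (w ω) hε)
      have hcle : ENNReal.ofReal c ≤ lowerRate F g ω := by
        refine le_iSup₂_of_le (f := fun (c : ℚ) (_ : ∃ C : ℕ, ∀ n : ℕ,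
          (c : ℝ) * n - C ≤ birkhoffSum F g n ω) => ENNReal.ofReal c) c ⟨0, fun n => ?_⟩ le_rfl
        have h1 := hcon n
        rw [hS] at h1
        have h2 : (c : ℝ) * n ≤ (w ω + ε) * n := by gcongr
        push_cast
        linarith
      have h3 := (ENNReal.ofReal_le_iff_le_toReal (hfin ω)).1 hcle
      linarith)
  have e : ∫ ω, (w ω + ε - g ω) ∂P = ∫ ω, w ω ∂P + ε - ∫ ω, g ω ∂P := by
    have h1 := integral_sub (hwi.add (integrable_const ε)) hg
    simp only [Pi.add_apply] at h1
    rw [h1, integral_add hwi (integrable_const ε)]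
    simp
  linarith

end Ergodic

/-! ### Atoms of a stationary measure. -/

theorem tsum_measure_singleton_ne_top (ν : Measure UnitAddCircle) [IsFiniteMeasure ν] :
    ∑' ξ, ν {ξ} ≠ ∞ :=
  ne_top_of_le_ne_top (measure_ne_top ν _)
    (tsum_meas_le_meas_iUnion_of_disjoint ν (fun ξ => measurableSet_singleton ξ)
      (fun _ _ h => Set.disjoint_singleton.2 h))

theorem ofReal_sub_sq_add_two_mul {x y : ℝ≥0∞} (hx : x ≠ ∞) (hy : y ≠ ∞) :
    ENNReal.ofReal ((x.toReal - y.toReal) ^ 2) + 2 * (x * y) = x ^ 2 + y ^ 2 := by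
  rw [← ENNReal.toReal_eq_toReal_iff' (by finiteness) (by finiteness),
    ENNReal.toReal_add (by finiteness) (by finiteness),
    ENNReal.toReal_add (by finiteness) (by finiteness), ENNReal.toReal_ofReal (sq_nonneg _)]
  simp only [ENNReal.toReal_mul, ENNReal.toReal_pow, ENNReal.toReal_ofNat]
  ring

theorem measurable_map_apply_of_measurableSet (ν : Measure UnitAddCircle) [IsFiniteMeasure ν]
    {B : Set UnitAddCircle} (hB : MeasurableSet B) :
    Measurable (fun T : CircleHomeo => ν.map T B) := by
  have h := measurable_measure_prodMk_left (ν := ν) (continuous_uncurry_apply.measurable hB)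
  convert h using 2 with T
  rw [Measure.map_apply T.measurable hB]
  rfl

theorem map_singleton_apply (ν : Measure UnitAddCircle) (T : CircleHomeo) (ξ : UnitAddCircle) :
    ν.map T {ξ} = ν {T.symm ξ} := by
  rw [Measure.map_apply T.measurable (measurableSet_singleton ξ)]
  congr 1
  ext η
  simp [Homeomorph.eq_symm_apply]

/-- Almost every homeomorphism preserves the masses of the atoms of a stationary measure. -/
theorem IsStationary.ae_measure_singleton_apply_eq {μ : Measure CircleHomeo}
    [IsProbabilityMeasure μ] {ν : Measure UnitAddCircle} [IsProbabilityMeasure ν]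
    (hν : IsStationary μ ν) : ∀ᵐ T : CircleHomeo ∂μ, ∀ ξ, ν {T ξ} = ν {ξ} := by
  set a : UnitAddCircle → ℝ≥0∞ := fun ξ => ν {ξ} with ha
  have hafin : ∀ ξ, a ξ ≠ ∞ := fun ξ => measure_ne_top ν _
  have ha1 : ∀ ξ, a ξ ≤ 1 := fun ξ => prob_le_one
  set A : Set UnitAddCircle := Function.support a with hA
  have hAc : A.Countable := Summable.countable_support_ennreal (tsum_measure_singleton_ne_top ν)
  have : Countable A := hAc.to_subtype
  have hsq : ∑' ξ, a ξ ^ 2 ≠ ∞ := by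
    refine ne_top_of_le_ne_top (tsum_measure_singleton_ne_top ν) (ENNReal.tsum_le_tsum fun ξ => ?_)
    rw [sq]
    exact mul_le_of_le_one_left' (ha1 ξ)
  have hsqA : ∑' ξ : A, a ξ ^ 2 = ∑' ξ, a ξ ^ 2 :=
    tsum_subtype_eq_of_support_subset (f := fun ξ => a ξ ^ 2) (s := A)
      (fun ξ hξ h0 => hξ (by simp [h0]))
  have hfm : ∀ ξ, Measurable fun T : CircleHomeo => a (T.symm ξ) := fun ξ => by
    have h := measurable_map_apply_of_measurableSet ν (measurableSet_singleton ξ)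
    simpa only [map_singleton_apply] using h
  have hfi : ∀ ξ, ∫⁻ T : CircleHomeo, a (T.symm ξ) ∂μ = a ξ := fun ξ => by
    rw [ha]
    simp only
    rw [hν {ξ} (measurableSet_singleton ξ)]
    simp only [map_singleton_apply]
  -- By stationarity a(ξ) is the mean of a(T⁻¹ξ), so `c ξ` is a variance. Each T permutes the points
  -- and so preserves ∑ a²; summing second moments over the atoms leaves no room for a positive
  -- variance.
  set c : UnitAddCircle → ℝ≥0∞ := fun ξ => ∫⁻ T : CircleHomeo,
    ENNReal.ofReal (((a (T.symm ξ)).toReal - (a ξ).toReal) ^ 2) ∂μ with hc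
  have hcm : ∀ ξ, Measurable fun T : CircleHomeo =>
      ENNReal.ofReal (((a (T.symm ξ)).toReal - (a ξ).toReal) ^ 2) := fun ξ =>
    (((hfm ξ).ennreal_toReal.sub_const _).pow_const 2).ennreal_ofReal
  have hid : ∀ ξ, c ξ + 2 * a ξ ^ 2 = ∫⁻ T : CircleHomeo, a (T.symm ξ) ^ 2 ∂μ + a ξ ^ 2 := by
    intro ξ
    have h1 : ∫⁻ T : CircleHomeo, (ENNReal.ofReal (((a (T.symm ξ)).toReal - (a ξ).toReal) ^ 2)
        + 2 * (a (T.symm ξ) * a ξ)) ∂μ = ∫⁻ T : CircleHomeo, (a (T.symm ξ) ^ 2 + a ξ ^ 2) ∂μ :=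
      lintegral_congr fun T => ofReal_sub_sq_add_two_mul (hafin _) (hafin _)
    rw [lintegral_add_left (hcm ξ), lintegral_add_right _ measurable_const,
      lintegral_const_mul _ ((hfm ξ).mul_const _), lintegral_mul_const _ (hfm ξ), hfi ξ] at h1
    simpa [sq, hc] using h1
  have hsum : ∑' ξ : A, ∫⁻ T : CircleHomeo, a (T.symm ξ) ^ 2 ∂μ ≤ ∑' ξ, a ξ ^ 2 := by
    rw [← lintegral_tsum fun ξ : A => ((hfm ξ).pow_const 2).aemeasurable]
    calc _ ≤ ∫⁻ _ : CircleHomeo, ∑' ξ, a ξ ^ 2 ∂μ := by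
          refine lintegral_mono fun T => ?_
          calc ∑' ξ : A, a (T.symm ξ) ^ 2 ≤ ∑' ξ, a (T.symm ξ) ^ 2 :=
                ENNReal.tsum_comp_le_tsum_of_injective Subtype.val_injective
                  fun ξ => a (T.symm ξ) ^ 2
            _ = ∑' ξ, a ξ ^ 2 := Equiv.tsum_eq T.symm.toEquiv fun ξ => a ξ ^ 2
      _ = ∑' ξ, a ξ ^ 2 := by simp
  have hc0 : ∀ ξ : A, c ξ = 0 := by
    have h1 : ∑' ξ : A, c ξ + 2 * ∑' ξ, a ξ ^ 2 ≤ 0 + 2 * ∑' ξ, a ξ ^ 2 := by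
      calc ∑' ξ : A, c ξ + 2 * ∑' ξ, a ξ ^ 2
          = ∑' ξ : A, (c ξ + 2 * a ξ ^ 2) := by
            rw [ENNReal.tsum_add, ENNReal.tsum_mul_left, hsqA]
        _ = ∑' ξ : A, (∫⁻ T : CircleHomeo, a (T.symm ξ) ^ 2 ∂μ + a ξ ^ 2) :=
            tsum_congr fun ξ => hid ξ
        _ ≤ 0 + 2 * ∑' ξ, a ξ ^ 2 := by
            rw [ENNReal.tsum_add, hsqA, zero_add, two_mul]
            gcongr
    have h2 := (ENNReal.add_le_add_iff_right (by finiteness)).1 h1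
    exact ENNReal.tsum_eq_zero.1 (le_antisymm h2 bot_le)
  have hae : ∀ᵐ T : CircleHomeo ∂μ, ∀ ξ : A, a (T.symm ξ) = a ξ := by
    refine ae_all_iff.2 fun ξ => ?_
    have h1 := (lintegral_eq_zero_iff (hcm ξ)).1 (hc0 ξ)
    filter_upwards [h1] with T hT
    simp only [Pi.zero_apply, ENNReal.ofReal_eq_zero] at hT
    have h2 := pow_eq_zero_iff (two_ne_zero) |>.1 (le_antisymm hT (sq_nonneg _))
    exact (ENNReal.toReal_eq_toReal_iff' (hafin _) (hafin _)).1 (sub_eq_zero.1 h2)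
  filter_upwards [hae] with T hT
  have hle : ∀ ξ, a ξ ≤ a (T.symm ξ) := by
    intro ξ
    by_cases h : ξ ∈ A
    · exact (hT ⟨ξ, h⟩).ge
    · rw [Function.notMem_support.1 h]
      exact bot_le
  -- Equality is so far known only at atoms. Elsewhere a strict inequality would make the total of a
  -- ∘ T⁻¹ exceed that of a.
  have heq : ∀ ξ, a ξ = a (T.symm ξ) := by
    by_contra! hcon
    obtain ⟨ξ, hξ⟩ := hcon
    have h1 := ENNReal.tsum_lt_tsum (tsum_measure_singleton_ne_top ν) hle
      (lt_of_le_of_ne (hle ξ) hξ)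
    exact absurd (Equiv.tsum_eq T.symm.toEquiv a) h1.ne'
  intro ξ
  simpa using heq (T ξ)

/-! ### Invariance of the path measure under the skew product. -/

section Shift

variable {X : Type*} [MeasurableSpace X]

theorem measurable_natCases : Measurable
    (fun p : X × (ℕ → X) => (fun n : ℕ => Nat.casesOn n p.1 p.2 : ℕ → X)) := by
  refine measurable_pi_iff.2 fun n => ?_
  cases n with
  | zero => exact measurable_fst
  | succ n => exact (measurable_pi_apply n).comp measurable_snd

/-- Checked on boxes; filling the index set up to an initial segment with full factors lets
coordinate 0 split off. -/
theorem map_natCases_prod_infinitePi (μ : Measure X) [IsProbabilityMeasure μ] :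
    (μ.prod (Measure.infinitePi fun _ : ℕ => μ)).map
      (fun p : X × (ℕ → X) => (fun n : ℕ => Nat.casesOn n p.1 p.2 : ℕ → X)) =
    Measure.infinitePi fun _ : ℕ => μ := by
  classical
  refine Measure.eq_infinitePi _ fun s t ht => ?_
  obtain ⟨N, hN⟩ : ∃ N, s ⊆ Finset.range (N + 1) :=
    ⟨s.sup id, fun i hi => Finset.mem_range.2 (Nat.lt_succ_of_le (Finset.le_sup (f := id) hi))⟩
  set t' : ℕ → Set X := fun i => if i ∈ s then t i else Set.univ with ht'
  have hpi : (s : Set ℕ).pi t = (Finset.range (N + 1) : Set ℕ).pi t' := by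
    ext x
    simp only [Set.mem_pi, Finset.mem_coe, ht']
    constructor
    · intro h i _
      by_cases hi : i ∈ s
      · simpa [hi] using h i hi
      · simp [hi]
    · intro h i hi
      simpa [hi] using h i (hN hi)
  have hprod : ∏ i ∈ s, μ (t i) = ∏ i ∈ Finset.range (N + 1), μ (t' i) := by
    rw [← Finset.prod_subset hN fun i _ hi => by simp [ht', hi]]
    exact Finset.prod_congr rfl fun i hi => by simp [ht', hi]
  have htm : ∀ i, MeasurableSet (t' i) := fun i => by
    by_cases hi : i ∈ s
    · simpa [ht', hi] using ht i
    · simp [ht', hi]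
  have hpre : (fun p : X × (ℕ → X) => (fun n : ℕ => Nat.casesOn n p.1 p.2 : ℕ → X)) ⁻¹'
      (Finset.range (N + 1) : Set ℕ).pi t' =
      t' 0 ×ˢ (Finset.range N : Set ℕ).pi fun i => t' (i + 1) := by
    ext p
    simp only [Set.mem_preimage, Set.mem_pi, Finset.mem_coe, Finset.mem_range, Set.mem_prod]
    constructor
    · exact fun h => ⟨h 0 (Nat.succ_pos N), fun i hi => h (i + 1) (Nat.succ_lt_succ hi)⟩
    · rintro ⟨h0, h⟩ i hi
      cases i with
      | zero => exact h0
      | succ i => exact h i (Nat.lt_of_succ_lt_succ hi)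
  rw [hpi, hprod, Measure.map_apply measurable_natCases
    (MeasurableSet.pi (Finset.countable_toSet _) fun i _ => htm i), hpre, Measure.prod_prod,
    Measure.infinitePi_pi _ fun i _ => htm (i + 1), Finset.prod_range_succ', mul_comm]

theorem measurePreserving_zero_succ (μ : Measure X) [IsProbabilityMeasure μ] :
    MeasurePreserving (fun x : ℕ → X => ((fun n => x (n + 1) : ℕ → X), x 0))
      (Measure.infinitePi fun _ : ℕ => μ) ((Measure.infinitePi fun _ : ℕ => μ).prod μ) := by
  have hm : Measurable (fun x : ℕ → X => ((fun n => x (n + 1) : ℕ → X), x 0)) :=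
    (measurable_pi_iff.2 fun n => measurable_pi_apply (n + 1)).prodMk (measurable_pi_apply 0)
  refine ⟨hm, ?_⟩
  conv_lhs => rw [← map_natCases_prod_infinitePi μ]
  rw [Measure.map_map hm measurable_natCases]
  exact Measure.prod_swap

end Shift

/-- The skew product `(x, ξ) ↦ (shift x, x₀ ξ)`. -/
def skew (p : (ℕ → CircleHomeo) × UnitAddCircle) : (ℕ → CircleHomeo) × UnitAddCircle :=
  (fun n => p.1 (n + 1), p.1 0 p.2)

theorem skew_iterate (x : ℕ → CircleHomeo) (ξ : UnitAddCircle) (n : ℕ) :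
    skew^[n] (x, ξ) = (fun k => x (k + n), iterate x n ξ) := by
  induction n with
  | zero => rfl
  | succ n ih =>
    rw [Function.iterate_succ_apply', ih, skew]
    simp only [zero_add]
    refine Prod.ext (funext fun k => ?_) rfl
    simp only [Nat.add_right_comm k 1 n, Nat.add_assoc]

variable {μ : Measure CircleHomeo} [IsProbabilityMeasure μ] {ν : Measure UnitAddCircle}
  [IsProbabilityMeasure ν]

instance : IsProbabilityMeasure (pathMeasure μ ν) := by
  unfold pathMeasure; infer_instance

/-- The tail of x is independent of (x₀, ξ), and stationarity says that x₀ξ again has law ν. -/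
theorem IsStationary.measurePreserving_skew (hν : IsStationary μ ν) :
    MeasurePreserving skew (pathMeasure μ ν) (pathMeasure μ ν) := by
  have h1 := (measurePreserving_zero_succ μ).prod (MeasurePreserving.id ν)
  have h2 := measurePreserving_prodAssoc (Measure.infinitePi fun _ : ℕ => μ) μ ν
  have h3 := (MeasurePreserving.id (Measure.infinitePi fun _ : ℕ => μ)).prod hν.measurePreserving
  exact h3.comp (h2.comp h1)

theorem measurePreserving_zero (μ : Measure CircleHomeo) [IsProbabilityMeasure μ]
    (ν : Measure UnitAddCircle) [IsProbabilityMeasure ν] :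
    MeasurePreserving (fun p : (ℕ → CircleHomeo) × UnitAddCircle => (p.1 0, p.2))
      (pathMeasure μ ν) (μ.prod ν) :=
  (measurePreserving_eval_infinitePi (fun _ : ℕ => μ) 0).prod (MeasurePreserving.id ν)

theorem IsStationary.ae_forall_of_ae_prod (hν : IsStationary μ ν)
    {Q : CircleHomeo × UnitAddCircle → Prop} (hQ : ∀ᵐ p ∂μ.prod ν, Q p) :
    ∀ᵐ p ∂pathMeasure μ ν, ∀ k : ℕ, Q (p.1 k, iterate p.1 k p.2) := by
  refine ae_all_iff.2 fun k => ?_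
  have h := ((measurePreserving_zero μ ν).comp
    (hν.measurePreserving_skew.iterate k)).quasiMeasurePreserving.ae hQ
  filter_upwards [h] with p hp
  simpa [skew_iterate p.1 p.2 k] using hp

theorem IsStationary.measurePreserving_iterate (hν : IsStationary μ ν) (k : ℕ) :
    MeasurePreserving (fun p : (ℕ → CircleHomeo) × UnitAddCircle => iterate p.1 k p.2)
      (pathMeasure μ ν) ν := by
  have h : MeasurePreserving (Prod.snd : (ℕ → CircleHomeo) × UnitAddCircle → UnitAddCircle)
      (pathMeasure μ ν) ν := measurePreserving_snd
  have h2 := h.comp (hν.measurePreserving_skew.iterate k)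
  convert h2 using 2 with p
  simp [skew_iterate p.1 p.2 k]

/-! ### Contraction of arcs along random orbits. -/

/-- Along almost every orbit, arcs of exponentially small measure have exponentially small
diameter, with almost the same rate. -/
theorem IsStationary.ae_eventually_isArc_subset (hν : IsStationary μ ν) {c c' : ℝ} (hc' : 0 < c')
    (hcc : c' < c) : ∀ᵐ p ∂pathMeasure μ ν, ∀ᶠ n : ℕ in atTop, ∀ J, IsArc J →
      iterate p.1 n p.2 ∈ J → ν J ≤ ENNReal.ofReal (Real.exp (-c * n)) →
      J ⊆ Metric.closedBall (iterate p.1 n p.2) (Real.exp (-c' * n)) := by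
  set B : ℕ → Set UnitAddCircle := fun n => {ξ | ∃ J, IsArc J ∧ ξ ∈ J ∧
    ¬ J ⊆ Metric.closedBall ξ (Real.exp (-c' * n)) ∧
    ν J ≤ ENNReal.ofReal (Real.exp (-c * n))} with hB
  have hBle : ∀ n, ν (B n) ≤ ENNReal.ofReal (4 * Real.exp (n * (-(c - c')))) := by
    intro n
    -- About e^{c'n} cells suffice for radius e^{-c'n}; the bad set then has measure at most
    -- 4e^{-(c-c')n}, which is summable.
    have hN : 1 / ((⌊Real.exp (c' * n)⌋₊ + 1 : ℕ) : ℝ) < Real.exp (-c' * n) := by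
      rw [neg_mul, Real.exp_neg, ← one_div]
      push_cast
      exact one_div_lt_one_div_of_lt (Real.exp_pos _) (Nat.lt_floor_add_one _)
    refine (measure_setOf_exists_isArc_not_subset_le ν (Nat.succ_pos _) hN _).trans ?_
    have h2 : ((⌊Real.exp (c' * n)⌋₊ + 1 : ℕ) : ℝ) ≤ 2 * Real.exp (c' * n) := by
      have h3 := Nat.floor_le (Real.exp_pos (c' * n)).le
      have h4 : 1 ≤ Real.exp (c' * n) := Real.one_le_exp (by positivity)
      push_cast
      linarith
    rw [← ENNReal.ofReal_natCast, ← ENNReal.ofReal_ofNat, ← ENNReal.ofReal_mul (by norm_num),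
      ← ENNReal.ofReal_mul (by positivity)]
    refine ENNReal.ofReal_le_ofReal ?_
    have h5 : Real.exp (n * (-(c - c'))) = Real.exp (c' * n) * Real.exp (-c * n) := by
      rw [← Real.exp_add]; ring_nf
    rw [h5]
    have h6 := mul_le_mul_of_nonneg_right h2
      (by positivity : 0 ≤ 2 * Real.exp (-c * n))
    calc _ ≤ _ := h6
      _ = _ := by ring
  have hsum : ∑' n, pathMeasure μ ν
      ((fun p : (ℕ → CircleHomeo) × UnitAddCircle => iterate p.1 n p.2) ⁻¹' B n) ≠ ∞ := by
    have hs : Summable fun n : ℕ => 4 * Real.exp (n * (-(c - c'))) :=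
      (Real.summable_exp_nat_mul_iff.2 (by linarith)).mul_left 4
    refine ne_top_of_le_ne_top hs.tsum_ofReal_ne_top (ENNReal.tsum_le_tsum fun n => ?_)
    exact ((hν.measurePreserving_iterate n).measure_preimage_le (B n)).trans (hBle n)
  filter_upwards [ae_eventually_notMem hsum] with p hp
  filter_upwards [hp] with n hn J hJ hJm hJν
  by_contra hcon
  exact hn ⟨J, hJ, hJm, hcon, hJν⟩

/-- The truncated exponent of contraction in measure of arcs of measure less than `1 / m`; it is
set to `0` at atoms. -/
noncomputable def arcRate (ν : Measure UnitAddCircle) (K : ℝ) (m : ℕ)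
    (p : CircleHomeo × UnitAddCircle) : ℝ :=
  {p : CircleHomeo × UnitAddCircle | ν {p.2} = 0}.indicator
    (fun p => -Real.log (max (maxRatio ν m p).toReal (Real.exp (-K)))) p

theorem measurableSet_measure_singleton_eq_zero (ν : Measure UnitAddCircle) [IsFiniteMeasure ν] :
    MeasurableSet {p : CircleHomeo × UnitAddCircle | ν {p.2} = 0} := by
  have h : (Function.support fun ξ => ν {ξ}).Countable :=
    Summable.countable_support_ennreal (tsum_measure_singleton_ne_top ν)
  have h2 : MeasurableSet ((Prod.snd : CircleHomeo × UnitAddCircle → UnitAddCircle) ⁻¹'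
      (Function.support fun ξ => ν {ξ})ᶜ) := measurable_snd h.measurableSet.compl
  convert h2 using 1
  ext p
  simp

theorem measurable_arcRate (ν : Measure UnitAddCircle) [IsFiniteMeasure ν] (K : ℝ) (m : ℕ) :
    Measurable (arcRate ν K m) := by
  refine Measurable.indicator ?_ (measurableSet_measure_singleton_eq_zero ν)
  exact (Real.measurable_log.comp
    ((measurable_maxRatio ν m).ennreal_toReal.max measurable_const)).neg

theorem neg_log_max_exp_neg_le (x K : ℝ) : -Real.log (max x (Real.exp (-K))) ≤ K := by
  have h := Real.log_le_log (Real.exp_pos (-K)) (le_max_right x (Real.exp (-K)))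
  rw [Real.log_exp] at h
  linarith

theorem arcRate_le (ν : Measure UnitAddCircle) {K : ℝ} (hK : 0 ≤ K) (m : ℕ)
    (p : CircleHomeo × UnitAddCircle) : arcRate ν K m p ≤ K := by
  refine Set.indicator_apply_le' (fun _ => ?_) fun _ => hK
  exact neg_log_max_exp_neg_le _ _

theorem maxRatio_le_exp_neg_arcRate {ν : Measure UnitAddCircle} (K : ℝ) {m : ℕ}
    {p : CircleHomeo × UnitAddCircle} (hp : maxRatio ν m p ≠ ∞) (hν : ν {p.2} = 0) :
    maxRatio ν m p ≤ ENNReal.ofReal (Real.exp (-arcRate ν K m p)) := by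
  rw [arcRate, Set.indicator_of_mem (by exact hν), neg_neg,
    Real.exp_log (lt_max_of_lt_right (Real.exp_pos _)), ← ENNReal.ofReal_toReal hp]
  refine ENNReal.ofReal_le_ofReal ?_
  rw [ENNReal.toReal_ofReal ENNReal.toReal_nonneg]
  exact le_max_left _ _

/-- Each step multiplies the measure of the arc by at most the exponential of minus the rate,
provided the arc is still below the threshold 1/m. The lower bound on all partial sums keeps it
there, so the induction never breaks. -/
theorem exists_isArc_forall_measure_image_le {ν : Measure UnitAddCircle} [IsProbabilityMeasure ν]
    {K c : ℝ} (hc : 0 ≤ c) {m : ℕ} {C : ℕ} {x : ℕ → CircleHomeo} {ξ : UnitAddCircle}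
    (hatom : ∀ k, ν {iterate x k ξ} = 0)
    (hfin : ∀ k, maxRatio ν m (x k, iterate x k ξ) ≠ ∞)
    (hS : ∀ n : ℕ, c * n - C ≤ ∑ k ∈ Finset.range n, arcRate ν K m (x k, iterate x k ξ)) :
    ∃ I, IsArc I ∧ ξ ∈ I ∧
      ∀ n : ℕ, ν (iterate x n '' I) ≤ ENNReal.ofReal (Real.exp (-c * n)) := by
  set S : ℕ → ℝ := fun n => ∑ k ∈ Finset.range n, arcRate ν K m (x k, iterate x k ξ) with hSdef
  -- The factor e^{-C} absorbs the constant in `hS`; the minimum keeps images below the threshold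
  -- and also yields the clean bound e^{-cn}, including for m = 0, where the inverse is ∞.
  set δ : ℝ≥0∞ := ENNReal.ofReal (Real.exp (-C)) * min 1 (m : ℝ≥0∞)⁻¹ with hδ
  have hδ0 : 0 < δ := by
    refine ENNReal.mul_pos (by simpa using Real.exp_pos _) (ne_of_gt (lt_min one_pos ?_))
    exact ENNReal.inv_pos.2 (ENNReal.natCast_ne_top m)
  have h0 : ν {ξ} = 0 := hatom 0
  obtain ⟨O, hξO, hO, hOδ⟩ := Set.exists_isOpen_lt_of_lt {ξ} δ (h0.trans_lt hδ0)
  obtain ⟨I, hIsub, hI, hξI⟩ := exists_isArc_subset (hO.mem_nhds (hξO rfl))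
  have hIδ : ν I < δ := (measure_mono hIsub).trans_lt hOδ
  have hIle : ∀ n : ℕ, ENNReal.ofReal (Real.exp (-S n)) * ν I <
      ENNReal.ofReal (Real.exp (-c * n)) * min 1 (m : ℝ≥0∞)⁻¹ := by
    intro n
    have h1 : Real.exp (-S n) * Real.exp (-C) ≤ Real.exp (-c * n) := by
      rw [← Real.exp_add]
      refine Real.exp_le_exp.2 ?_
      linarith [hS n]
    calc _ < ENNReal.ofReal (Real.exp (-S n)) * δ :=
          ENNReal.mul_lt_mul_right (by simpa using Real.exp_pos _) ENNReal.ofReal_ne_top hIδ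
      _ = ENNReal.ofReal (Real.exp (-S n) * Real.exp (-C)) * min 1 (m : ℝ≥0∞)⁻¹ := by
          rw [hδ, ← mul_assoc, ← ENNReal.ofReal_mul (Real.exp_pos _).le]
      _ ≤ _ := by gcongr
  have hind : ∀ n : ℕ, ν (iterate x n '' I) ≤ ENNReal.ofReal (Real.exp (-S n)) * ν I := by
    intro n
    induction n with
    | zero => simp [hSdef, iterate]
    | succ n ih =>
      have hlt : ν (iterate x n '' I) < (m : ℝ≥0∞)⁻¹ := by
        refine (ih.trans_lt (hIle n)).trans_le ?_
        calc _ ≤ 1 * (m : ℝ≥0∞)⁻¹ := by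
              refine mul_le_mul' ?_ (min_le_right _ _)
              rw [← ENNReal.ofReal_one]
              refine ENNReal.ofReal_le_ofReal (Real.exp_le_one_iff.2 ?_)
              have : 0 ≤ c * n := by positivity
              linarith
          _ = _ := one_mul _
      have himg : iterate x (n + 1) '' I = x n '' (iterate x n '' I) := by
        rw [Set.image_image]; rfl
      have hstep := measure_image_le_maxRatio_mul ν (p := (x n, iterate x n ξ)) (hfin n)
        (hI.image (iterate x n)) (Set.mem_image_of_mem _ hξI) hlt
      rw [himg]
      refine hstep.trans ?_
      calc _ ≤ ENNReal.ofReal (Real.exp (-arcRate ν K m (x n, iterate x n ξ))) *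
            (ENNReal.ofReal (Real.exp (-S n)) * ν I) :=
            mul_le_mul' (maxRatio_le_exp_neg_arcRate K (hfin n) (hatom n)) ih
        _ = ENNReal.ofReal (Real.exp (-S (n + 1))) * ν I := by
            rw [← mul_assoc, ← ENNReal.ofReal_mul (Real.exp_pos _).le, ← Real.exp_add, hSdef]
            simp only [Finset.sum_range_succ]
            ring_nf
  refine ⟨I, hI, hξI, fun n => (hind n).trans ((hIle n).le.trans ?_)⟩
  exact mul_le_of_le_one_right' (min_le_left _ _)

theorem ofReal_le_contractionExponent {x : ℕ → CircleHomeo} {ξ : UnitAddCircle} {c' : ℝ}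
    {I : Set UnitAddCircle} (hI : IsArc I) (hξ : ξ ∈ I)
    (h : ∀ᶠ n : ℕ in atTop, iterate x n '' I ⊆
      Metric.closedBall (iterate x n ξ) (Real.exp (-c' * n))) :
    ENNReal.ofReal c' ≤ (contractionExponent x ξ).toENNReal := by
  have e : ENNReal.ofReal c' = (c' : EReal).toENNReal := by
    rw [EReal.toENNReal_of_ne_top (EReal.coe_ne_top c'), EReal.toReal_coe]
  rw [e]
  refine EReal.toENNReal_le_toENNReal ?_
  refine le_liminf_of_le (by isBoundedDefault) ?_
  have h1 : ∀ᶠ η in 𝓝[≠] ξ, η ∈ I := mem_nhdsWithin_of_mem_nhds (hI.1.mem_nhds hξ)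
  filter_upwards [h1, self_mem_nhdsWithin] with η hη hne
  refine le_liminf_of_le (by isBoundedDefault) ?_
  filter_upwards [h, eventually_gt_atTop 0] with n hn hn0
  have hd := hn (Set.mem_image_of_mem _ hη)
  rw [Metric.mem_closedBall] at hd
  have hpos : 0 < dist (iterate x n η) (iterate x n ξ) :=
    dist_pos.2 fun h => hne ((iterate x n).injective h)
  have hlog := Real.log_le_log hpos hd
  rw [Real.log_exp] at hlog
  have hn' : (0 : ℝ) < n := by exact_mod_cast hn0
  refine EReal.coe_le_coe_iff.2 ?_
  have h2 : c' * n ≤ -Real.log (dist (iterate x n η) (iterate x n ξ)) := by linarith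
  rw [show -(1 / (n : ℝ)) * Real.log (dist (iterate x n η) (iterate x n ξ)) =
    -Real.log (dist (iterate x n η) (iterate x n ξ)) / n by ring]
  rwa [le_div_iff₀ hn']

theorem ae_maxRatio_ne_top (μ : Measure CircleHomeo) [IsProbabilityMeasure μ]
    (ν : Measure UnitAddCircle) [IsProbabilityMeasure ν] (m : ℕ) :
    ∀ᵐ p ∂μ.prod ν, maxRatio ν m p ≠ ∞ := by
  rw [ae_iff]
  by_contra hne
  obtain ⟨n, hn⟩ := ENNReal.exists_nat_mul_gt hne ENNReal.ofNat_ne_top (b := 2)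
  refine absurd hn (not_lt.2 (le_trans ?_ (mul_prod_measure_lt_maxRatio_le μ ν m n)))
  refine mul_le_mul' le_rfl (measure_mono fun p hp => ?_)
  have hp' : maxRatio ν m p = ∞ := not_not.1 hp
  show (n : ℝ≥0∞) < maxRatio ν m p
  rw [hp']
  exact ENNReal.natCast_lt_top n

theorem IsStationary.ae_measure_singleton_apply_eq_prod (hν : IsStationary μ ν) :
    ∀ᵐ p ∂μ.prod ν, ν {p.1 p.2} = ν {p.2} := by
  filter_upwards [Measure.quasiMeasurePreserving_fst.ae hν.ae_measure_singleton_apply_eq]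
    with p hp using hp p.2

theorem birkhoffSum_skew_arcRate (ν : Measure UnitAddCircle) (K : ℝ) (m n : ℕ)
    (p : (ℕ → CircleHomeo) × UnitAddCircle) :
    birkhoffSum skew (fun p => arcRate ν K m (p.1 0, p.2)) n p =
      ∑ k ∈ Finset.range n, arcRate ν K m (p.1 k, iterate p.1 k p.2) := by
  refine Finset.sum_congr rfl fun k _ => ?_
  rw [← Prod.mk.eta (p := p), skew_iterate p.1 p.2 k]
  simp

/-- An admissible rate c > 0 gives an arc whose images have measure at most e^{-cn}, hence
eventually radius at most e^{-c'n} for every rational c' in (0, c). -/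
theorem IsStationary.ae_lowerRate_le_contractionExponent (hν : IsStationary μ ν) (K : ℝ) (m : ℕ) :
    ∀ᵐ p ∂pathMeasure μ ν, lowerRate skew (fun p => arcRate ν K m (p.1 0, p.2)) p ≤
      (contractionExponent p.1 p.2).toENNReal := by
  have hBC : ∀ᵐ p ∂pathMeasure μ ν, ∀ c c' : ℚ, 0 < (c' : ℝ) → (c' : ℝ) < c →
      ∀ᶠ n : ℕ in atTop, ∀ J, IsArc J →
      iterate p.1 n p.2 ∈ J → ν J ≤ ENNReal.ofReal (Real.exp (-(c : ℝ) * n)) →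
      J ⊆ Metric.closedBall (iterate p.1 n p.2) (Real.exp (-(c' : ℝ) * n)) := by
    refine ae_all_iff.2 fun c => ae_all_iff.2 fun c' => ?_
    by_cases h : 0 < (c' : ℝ) ∧ (c' : ℝ) < c
    · filter_upwards [hν.ae_eventually_isArc_subset h.1 h.2] with p hp _ _ using hp
    · exact Eventually.of_forall fun p h1 h2 => absurd ⟨h1, h2⟩ h
  filter_upwards [hBC, hν.ae_forall_of_ae_prod (ae_maxRatio_ne_top μ ν m),
    hν.ae_forall_of_ae_prod hν.ae_measure_singleton_apply_eq_prod] with p hp hfin hatom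
  have hmass : ∀ k, ν {iterate p.1 k p.2} = ν {p.2} := by
    intro k
    induction k with
    | zero => rfl
    | succ k ih => rw [← ih]; exact hatom k
  refine iSup₂_le fun c hc => ?_
  obtain ⟨C, hC⟩ := hc
  simp only [birkhoffSum_skew_arcRate] at hC
  rcases le_or_gt (c : ℝ) 0 with hc0 | hc0
  · rw [ENNReal.ofReal_of_nonpos hc0]
    exact bot_le
  by_cases h0 : ν {p.2} = 0
  · obtain ⟨I, hI, hξI, hle⟩ := exists_isArc_forall_measure_image_le hc0.le
      (fun k => (hmass k).trans h0) hfin hC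
    refine le_of_forall_lt fun b hb => ?_
    obtain ⟨c', hc'0, hbc', hc'c⟩ := ENNReal.lt_iff_exists_rat_btwn.1 hb
    have hc'c' : (c' : ℝ) < c := (ENNReal.ofReal_lt_ofReal_iff hc0).1 hc'c
    have hc'pos : 0 < (c' : ℝ) := by
      have := bot_le.trans_lt hbc'
      exact ENNReal.ofReal_pos.1 this
    refine hbc'.trans_le (ofReal_le_contractionExponent hI hξI ?_)
    filter_upwards [hp c c' hc'pos hc'c'] with n hn
    exact hn _ (hI.image _) (Set.mem_image_of_mem _ hξI) (hle n)
  -- The whole orbit of an atom consists of atoms of the same mass, so every Birkhoff sum is 0 and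
  -- no positive rate is admissible.
  · exfalso
    have hz : ∀ k, arcRate ν K m (p.1 k, iterate p.1 k p.2) = 0 := by
      intro k
      rw [arcRate]
      refine Set.indicator_of_notMem ?_ _
      exact fun h => h0 ((hmass k).symm.trans h)
    obtain ⟨n, hn⟩ := exists_nat_gt (C / c : ℝ)
    rw [div_lt_iff₀ hc0] at hn
    have := hC n
    simp only [hz, Finset.sum_const_zero] at this
    linarith

/-- A pointwise bound for the truncated rate by a sum of tail indicators of the maximal function. -/
theorem enorm_neg_log_max_le {K : ℝ} (hK : 0 ≤ K) (y : ℝ≥0∞) :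
    ‖-Real.log (max y.toReal (Real.exp (-K)))‖ₑ ≤ ENNReal.ofReal K +
      ∑' k : ℕ, {z : ℝ≥0∞ | ENNReal.ofReal (Real.exp k) < z}.indicator 1 y := by
  set M := max y.toReal (Real.exp (-K)) with hM
  have hM0 : 0 < M := lt_max_of_lt_right (Real.exp_pos _)
  have hlow : -Real.log M ≤ K := neg_log_max_exp_neg_le _ _
  rw [enorm_neg, ← ofReal_norm, Real.norm_eq_abs]
  rcases le_or_gt (Real.log M) 0 with h | h
  · rw [abs_of_nonpos h]
    exact (ENNReal.ofReal_le_ofReal hlow).trans le_self_add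
  · rw [abs_of_pos h]
    refine le_trans ?_ le_add_self
    have hM1 : 1 < M := (Real.log_pos_iff hM0.le).1 h
    have hMy : M = y.toReal := by
      rcases max_choice y.toReal (Real.exp (-K)) with h1 | h1
      · exact h1
      · rw [← hM] at h1
        have : Real.exp (-K) ≤ 1 := Real.exp_le_one_iff.2 (by linarith)
        linarith
    have hytop : y ≠ ∞ := by
      rintro rfl
      rw [ENNReal.toReal_top] at hMy
      linarith
    have hmem : ∀ k ∈ Finset.range ⌈Real.log M⌉₊,
        y ∈ {z : ℝ≥0∞ | ENNReal.ofReal (Real.exp k) < z} := by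
      intro k hk
      have h1 := Nat.lt_ceil.1 (Finset.mem_range.1 hk)
      have h2 : Real.exp k < y.toReal := by rwa [← hMy, ← Real.lt_log_iff_exp_lt hM0]
      exact (ENNReal.ofReal_lt_iff_lt_toReal (Real.exp_pos _).le hytop).2 h2
    calc ENNReal.ofReal (Real.log M) ≤ ENNReal.ofReal (⌈Real.log M⌉₊ : ℝ) :=
          ENNReal.ofReal_le_ofReal (Nat.le_ceil _)
      _ = ∑ k ∈ Finset.range ⌈Real.log M⌉₊,
            {z : ℝ≥0∞ | ENNReal.ofReal (Real.exp k) < z}.indicator 1 y := by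
          rw [Finset.sum_congr rfl fun k hk => Set.indicator_of_mem (hmem k hk) 1]
          simp
      _ ≤ _ := ENNReal.sum_le_tsum _

/-- The weak type bound gives tails of size 2e^{-k} for the logarithm of the maximal ratio, which
are summable; no strong type bound is needed. -/
theorem integrable_arcRate (μ : Measure CircleHomeo) [IsProbabilityMeasure μ]
    (ν : Measure UnitAddCircle) [IsProbabilityMeasure ν] {K : ℝ} (hK : 0 ≤ K) (m : ℕ) :
    Integrable (arcRate ν K m) (μ.prod ν) := by
  refine ⟨(measurable_arcRate ν K m).aestronglyMeasurable, ?_⟩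
  have hms : ∀ k : ℕ, MeasurableSet {p | ENNReal.ofReal (Real.exp k) < maxRatio ν m p} := fun k =>
    measurableSet_lt measurable_const (measurable_maxRatio ν m)
  have hbound : ∀ k : ℕ, μ.prod ν {p | ENNReal.ofReal (Real.exp k) < maxRatio ν m p} ≤
      ENNReal.ofReal (2 * Real.exp (-k)) := by
    intro k
    have h := mul_prod_measure_lt_maxRatio_le μ ν m (ENNReal.ofReal (Real.exp k))
    rw [mul_comm, ← ENNReal.le_div_iff_mul_le (Or.inl (by simpa using Real.exp_pos _))
      (Or.inl ENNReal.ofReal_ne_top)] at h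
    refine h.trans_eq ?_
    rw [Real.exp_neg, ← div_eq_mul_inv, ENNReal.ofReal_div_of_pos (Real.exp_pos _)]
    simp
  calc ∫⁻ p, ‖arcRate ν K m p‖ₑ ∂μ.prod ν
      ≤ ∫⁻ p, (ENNReal.ofReal K + ∑' k : ℕ,
          {p | ENNReal.ofReal (Real.exp k) < maxRatio ν m p}.indicator 1 p) ∂μ.prod ν := by
        refine lintegral_mono fun p => ?_
        refine le_trans ?_ (enorm_neg_log_max_le hK (maxRatio ν m p))
        exact enorm_indicator_le_enorm_self _ _
    _ = ENNReal.ofReal K + ∑' k : ℕ,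
          μ.prod ν {p | ENNReal.ofReal (Real.exp k) < maxRatio ν m p} := by
        rw [lintegral_add_left measurable_const,
          lintegral_tsum fun k => (measurable_one.indicator (hms k)).aemeasurable]
        simp [lintegral_indicator_one (hms _)]
    _ ≤ ENNReal.ofReal K + ∑' k : ℕ, ENNReal.ofReal (2 * Real.exp (-k)) := by
        gcongr with k
        exact hbound k
    _ < ∞ := by
        refine ENNReal.add_lt_top.2 ⟨ENNReal.ofReal_lt_top, lt_top_iff_ne_top.2 ?_⟩
        exact (Real.summable_exp_neg_nat.mul_left 2).tsum_ofReal_ne_top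

theorem IsStationary.ofReal_integral_arcRate_le (hν : IsStationary μ ν) {K : ℝ} (hK : 0 ≤ K)
    (m : ℕ) : ENNReal.ofReal (∫ p, arcRate ν K m p ∂μ.prod ν) ≤ integralContractionExponent μ ν := by
  have hmp := measurePreserving_zero μ ν
  have h1 := ofReal_integral_le_lintegral_lowerRate hν.measurePreserving_skew
    (g := fun p => arcRate ν K m (p.1 0, p.2))
    ((measurable_arcRate ν K m).comp hmp.measurable)
    (hmp.integrable_comp_of_integrable (integrable_arcRate μ ν hK m))
    (fun p => arcRate_le ν hK m _)
  have h2 : ∫ p, arcRate ν K m (p.1 0, p.2) ∂pathMeasure μ ν = ∫ p, arcRate ν K m p ∂μ.prod ν := by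
    rw [← hmp.map_eq, integral_map hmp.measurable.aemeasurable
      (measurable_arcRate ν K m).aestronglyMeasurable]
  rw [h2] at h1
  exact h1.trans (lintegral_mono_ae (hν.ae_lowerRate_le_contractionExponent K m))

/-! ### From the maximal ratio to the density: the truncated entropy. -/

instance (T : CircleHomeo) : IsProbabilityMeasure (ν.map T.symm) :=
  Measure.isProbabilityMeasure_map T.symm.measurable.aemeasurable

theorem map_symm_map (ν : Measure UnitAddCircle) (T : CircleHomeo) :
    (ν.map T.symm).map T = ν := by
  rw [Measure.map_map T.measurable T.symm.measurable, T.self_comp_symm, Measure.map_id]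

theorem map_map_symm (ν : Measure UnitAddCircle) (T : CircleHomeo) :
    (ν.map T).map T.symm = ν := by
  rw [Measure.map_map T.symm.measurable T.measurable, T.symm_comp_self, Measure.map_id]

theorem withDensity_pullbackDensity_le (ν : Measure UnitAddCircle) [IsProbabilityMeasure ν]
    (T : CircleHomeo) : ν.withDensity (fun ξ => pullbackDensity ν (T, ξ)) ≤ ν.map T.symm := by
  rw [withDensity_congr_ae (pullbackDensity_ae_eq ν T)]
  exact Measure.withDensity_rnDeriv_le _ _

theorem one_le_rnDeriv_of_measure_singleton_eq {ρ ν : Measure UnitAddCircle} [IsFiniteMeasure ν]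
    [IsFiniteMeasure ρ] {ξ : UnitAddCircle} (h : ρ {ξ} = ν {ξ}) (h0 : ν {ξ} ≠ 0) :
    1 ≤ ρ.rnDeriv ν ξ := by
  have := Measure.haveLebesgueDecomposition_of_sigmaFinite ρ ν
  obtain ⟨N, hN, hN0, hNc⟩ := Measure.mutuallySingular_singularPart ρ ν
  have hξN : ξ ∈ N := by
    by_contra hcon
    exact h0 (measure_mono_null (Set.singleton_subset_iff.2 hcon) hNc)
  have h1 : ν {ξ} = ρ.rnDeriv ν ξ * ν {ξ} := by
    conv_lhs => rw [← h, Measure.haveLebesgueDecomposition_add ρ ν]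
    rw [Measure.add_apply, measure_mono_null (Set.singleton_subset_iff.2 hξN) hN0, zero_add,
      withDensity_apply _ (measurableSet_singleton ξ), lintegral_singleton]
  by_contra! hcon
  have h2 := ENNReal.mul_lt_mul_left h0 (measure_ne_top ν _) hcon
  rw [one_mul, ← h1] at h2
  exact lt_irrefl _ h2

/-- Guarantees that setting `arcRate` to 0 at atoms only increases the rate: there −log of the
density is at most 0. -/
theorem IsStationary.ae_one_le_pullbackDensity (hν : IsStationary μ ν) :
    ∀ᵐ p ∂μ.prod ν, ν {p.2} ≠ 0 → 1 ≤ pullbackDensity ν p := by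
  have hm : MeasurableSet {p : CircleHomeo × UnitAddCircle |
      ν {p.2} ≠ 0 → 1 ≤ pullbackDensity ν p} := by
    have h := (measurableSet_measure_singleton_eq_zero ν).union
      (measurableSet_le measurable_const (measurable_pullbackDensity ν) :
        MeasurableSet {p | 1 ≤ pullbackDensity ν p})
    convert h using 1
    ext p
    simp only [Set.mem_union, Set.mem_ofPred_eq]
    tauto
  rw [Measure.ae_prod_iff_ae_ae hm]
  filter_upwards [hν.ae_measure_singleton_apply_eq] with T hT
  filter_upwards [pullbackDensity_ae_eq ν T] with ξ hξ h0
  rw [hξ]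
  refine one_le_rnDeriv_of_measure_singleton_eq ?_ h0
  rw [map_symm_apply ν T (measurableSet_singleton ξ), Set.image_singleton, hT]

/-- The logarithmic rate `-log y`, truncated above at `K`. -/
noncomputable def truncRate (K : ℝ) (y : ℝ≥0∞) : ℝ := -Real.log (max y.toReal (Real.exp (-K)))

theorem measurable_truncRate (K : ℝ) : Measurable (truncRate K) :=
  (Real.measurable_log.comp (ENNReal.measurable_toReal.max measurable_const)).neg

theorem truncRate_le (K : ℝ) (y : ℝ≥0∞) : truncRate K y ≤ K := neg_log_max_exp_neg_le _ _

/-- Finiteness of z matters because `toReal` sends ∞ to 0. -/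
theorem truncRate_anti (K : ℝ) {y z : ℝ≥0∞} (hz : z ≠ ∞) (h : y ≤ z) :
    truncRate K z ≤ truncRate K y := by
  refine neg_le_neg (Real.log_le_log (lt_max_of_lt_right (Real.exp_pos _)) ?_)
  exact max_le_max (ENNReal.toReal_mono hz h) le_rfl

theorem continuous_log_max_exp (K : ℝ) :
    Continuous fun x : ℝ => -Real.log (max x (Real.exp (-K))) := by
  refine (Continuous.log (continuous_id.max continuous_const) fun x => ?_).neg
  exact (lt_max_of_lt_right (Real.exp_pos _)).ne'

theorem neg_le_truncRate {K : ℝ} (hK : 0 ≤ K) (y : ℝ≥0∞) : -y.toReal ≤ truncRate K y := by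
  rw [truncRate]
  refine neg_le_neg ?_
  rcases max_choice y.toReal (Real.exp (-K)) with h | h
  · rw [h]
    exact Real.log_le_self ENNReal.toReal_nonneg
  · rw [h, Real.log_exp]
    linarith [ENNReal.toReal_nonneg (a := y)]

theorem lintegral_prod_pullbackDensity_le (μ : Measure CircleHomeo) [IsProbabilityMeasure μ]
    (ν : Measure UnitAddCircle) [IsProbabilityMeasure ν] :
    ∫⁻ p, pullbackDensity ν p ∂μ.prod ν ≤ 1 := by
  rw [lintegral_prod _ (measurable_pullbackDensity ν).aemeasurable]
  calc _ ≤ ∫⁻ _ : CircleHomeo, 1 ∂μ := lintegral_mono fun T => lintegral_pullbackDensity_le ν T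
    _ = 1 := by simp

theorem integrable_toReal_pullbackDensity (μ : Measure CircleHomeo) [IsProbabilityMeasure μ]
    (ν : Measure UnitAddCircle) [IsProbabilityMeasure ν] :
    Integrable (fun p => (pullbackDensity ν p).toReal) (μ.prod ν) :=
  integrable_toReal_of_lintegral_ne_top (measurable_pullbackDensity ν).aemeasurable
    (ne_top_of_le_ne_top ENNReal.one_ne_top (lintegral_prod_pullbackDensity_le μ ν))

theorem integrable_truncRate_pullbackDensity (μ : Measure CircleHomeo) [IsProbabilityMeasure μ]
    (ν : Measure UnitAddCircle) [IsProbabilityMeasure ν] {K : ℝ} (hK : 0 ≤ K) :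
    Integrable (fun p => truncRate K (pullbackDensity ν p)) (μ.prod ν) := by
  refine Integrable.mono' ((integrable_const K).add (integrable_toReal_pullbackDensity μ ν))
    ((measurable_truncRate K).comp (measurable_pullbackDensity ν)).aestronglyMeasurable
    (Eventually.of_forall fun p => ?_)
  rw [Real.norm_eq_abs, abs_le]
  have h1 := neg_le_truncRate hK (pullbackDensity ν p)
  have h2 := truncRate_le K (pullbackDensity ν p)
  have h3 := ENNReal.toReal_nonneg (a := pullbackDensity ν p)
  constructor <;> simp only [Pi.add_apply] <;> linarith

/-- The truncated entropy is at most the integral of the local contraction exponent. -/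
theorem IsStationary.ofReal_integral_truncRate_le (hν : IsStationary μ ν) {K : ℝ} (hK : 0 ≤ K) :
    ENNReal.ofReal (∫ p, truncRate K (pullbackDensity ν p) ∂μ.prod ν) ≤
      integralContractionExponent μ ν := by
  set L : CircleHomeo × UnitAddCircle → ℝ :=
    {p : CircleHomeo × UnitAddCircle | ν {p.2} = 0}.indicator
      (fun p => truncRate K (⨅ m, maxRatio ν m p)) with hL
  have hLm : Measurable L := ((measurable_truncRate K).comp
    (Measurable.iInf fun m => measurable_maxRatio ν m)).indicator
      (measurableSet_measure_singleton_eq_zero ν)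
  have hfin : ∀ᵐ p ∂μ.prod ν, ∀ m, maxRatio ν m p ≠ ∞ :=
    ae_all_iff.2 fun m => ae_maxRatio_ne_top μ ν m
  have hbd : ∀ x y : ℝ, x ≤ y → y ≤ K → ‖y‖ ≤ |x| + K := by
    intro x y hxy hy
    rw [Real.norm_eq_abs, abs_le]
    constructor <;> linarith [neg_abs_le x, abs_nonneg x]
  -- The rates increase with m and stay at most K, so this dominates them all; for m = 0 the
  -- threshold is ∞ and every arc is allowed.
  have hint : Integrable (fun p => |arcRate ν K 0 p| + K) (μ.prod ν) :=
    (integrable_arcRate μ ν hK 0).abs.add (integrable_const K)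
  have hlim : ∀ᵐ p ∂μ.prod ν, Tendsto (fun m => arcRate ν K m p) atTop (𝓝 (L p)) := by
    filter_upwards [hfin] with p hp
    by_cases h0 : ν {p.2} = 0
    · have e : ∀ m, arcRate ν K m p = truncRate K (maxRatio ν m p) := fun m =>
        Set.indicator_of_mem (by exact h0) _
      have e' : L p = truncRate K (⨅ m, maxRatio ν m p) := Set.indicator_of_mem (by exact h0) _
      simp only [e, e']
      have h1 : Tendsto (fun m => maxRatio ν m p) atTop (𝓝 (⨅ m, maxRatio ν m p)) :=
        tendsto_atTop_iInf fun _ _ h => maxRatio_anti ν h p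
      have h2 := (ENNReal.tendsto_toReal
        (ne_top_of_le_ne_top (hp 0) (iInf_le _ 0))).comp h1
      exact ((continuous_log_max_exp K).tendsto _).comp h2
    · have e : ∀ m, arcRate ν K m p = 0 := fun m => Set.indicator_of_notMem (by exact h0) _
      have e' : L p = 0 := Set.indicator_of_notMem (by exact h0) _
      simp only [e, e']
      exact tendsto_const_nhds
  have hmono : ∀ᵐ p ∂μ.prod ν, ∀ m, ‖arcRate ν K m p‖ ≤ |arcRate ν K 0 p| + K := by
    filter_upwards [hfin] with p hp m
    refine hbd _ _ ?_ (arcRate_le ν hK m p)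
    refine Set.indicator_le_indicator ?_
    exact truncRate_anti K (hp 0) (maxRatio_anti ν (Nat.zero_le m) p)
  have hLint : Integrable L (μ.prod ν) := by
    refine Integrable.mono' hint hLm.aestronglyMeasurable ?_
    filter_upwards [hlim, hmono] with p h1 h2
    exact le_of_tendsto' h1.norm h2
  have hconv : Tendsto (fun m => ∫ p, arcRate ν K m p ∂μ.prod ν) atTop
      (𝓝 (∫ p, L p ∂μ.prod ν)) :=
    tendsto_integral_of_dominated_convergence _
      (fun m => (measurable_arcRate ν K m).aestronglyMeasurable) hint
      (fun m => hmono.mono fun p hp => hp m) hlim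
  have hle : ∫ p, truncRate K (pullbackDensity ν p) ∂μ.prod ν ≤ ∫ p, L p ∂μ.prod ν := by
    refine integral_mono_ae (integrable_truncRate_pullbackDensity μ ν hK) hLint ?_
    have hqfin : ∀ᵐ p ∂μ.prod ν, pullbackDensity ν p < ∞ :=
      ae_lt_top (measurable_pullbackDensity ν)
        (ne_top_of_le_ne_top ENNReal.one_ne_top (lintegral_prod_pullbackDensity_le μ ν))
    filter_upwards [ae_prod_iInf_maxRatio_le μ ν, hν.ae_one_le_pullbackDensity, hqfin]
      with p h1 h2 h3
    by_cases h0 : ν {p.2} = 0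
    · rw [show L p = truncRate K (⨅ m, maxRatio ν m p) from Set.indicator_of_mem (by exact h0) _]
      exact truncRate_anti K h3.ne h1
    · rw [show L p = 0 from Set.indicator_of_notMem (by exact h0) _]
      refine (truncRate_anti K h3.ne (h2 h0)).trans ?_
      rw [truncRate, ENNReal.toReal_one, neg_nonpos]
      exact Real.log_nonneg (le_max_left _ _)
  refine (ENNReal.ofReal_le_ofReal hle).trans ?_
  exact le_of_tendsto' (ENNReal.tendsto_ofReal hconv) fun m => hν.ofReal_integral_arcRate_le hK m

/-! ### The entropy inequality and the rigidity statement. -/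

/-- Truncation only acts for y < e^{-K} ≤ 1, where −log y is positive, so the negative part does not
depend on K. -/
theorem ofReal_neg_truncRate {K : ℝ} (hK : 0 ≤ K) (y : ℝ≥0∞) :
    ENNReal.ofReal (-truncRate K y) = ENNReal.ofReal (Real.log y.toReal) := by
  rw [truncRate, neg_neg]
  rcases le_total (Real.exp (-K)) y.toReal with h | h
  · rw [max_eq_left h]
  · rw [max_eq_right h, Real.log_exp, ENNReal.ofReal_of_nonpos (by linarith),
      ENNReal.ofReal_of_nonpos]
    exact Real.log_nonpos ENNReal.toReal_nonneg (h.trans (Real.exp_le_one_iff.2 (by linarith)))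

theorem lintegral_ofReal_log_pullbackDensity_ne_top (μ : Measure CircleHomeo)
    [IsProbabilityMeasure μ] (ν : Measure UnitAddCircle) [IsProbabilityMeasure ν] :
    ∫⁻ p, ENNReal.ofReal (Real.log (pullbackDensity ν p).toReal) ∂μ.prod ν ≠ ∞ := by
  refine ne_top_of_le_ne_top ENNReal.one_ne_top
    ((lintegral_mono fun p => ?_).trans (lintegral_prod_pullbackDensity_le μ ν))
  exact (ENNReal.ofReal_le_ofReal (Real.log_le_self ENNReal.toReal_nonneg)).trans
    ENNReal.ofReal_toReal_le

/-- Moving the finite negative part, independent of K, to the right leaves an increasing integrand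
on the left, ready for monotone convergence in K. -/
theorem IsStationary.lintegral_ofReal_truncRate_le (hν : IsStationary μ ν) {K : ℝ} (hK : 0 ≤ K) :
    ∫⁻ p, ENNReal.ofReal (truncRate K (pullbackDensity ν p)) ∂μ.prod ν ≤
      integralContractionExponent μ ν +
        ∫⁻ p, ENNReal.ofReal (Real.log (pullbackDensity ν p).toReal) ∂μ.prod ν := by
  have hi := integrable_truncRate_pullbackDensity μ ν hK
  have h1 := integral_eq_lintegral_pos_part_sub_lintegral_neg_part hi
  simp only [ofReal_neg_truncRate hK] at h1
  have hpos : ∫⁻ p, ENNReal.ofReal (truncRate K (pullbackDensity ν p)) ∂μ.prod ν ≠ ∞ :=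
    hi.lintegral_lt_top.ne
  have hneg := lintegral_ofReal_log_pullbackDensity_ne_top μ ν
  rw [← ENNReal.ofReal_toReal hpos, ← ENNReal.ofReal_toReal hneg,
    eq_add_of_sub_eq h1.symm]
  refine ENNReal.ofReal_add_le.trans ?_
  gcongr
  exact hν.ofReal_integral_truncRate_le hK

theorem absolutelyContinuous_of_ae_pullbackDensity_ne_zero {T : CircleHomeo}
    (h : ∀ᵐ ξ ∂ν, pullbackDensity ν (T, ξ) ≠ 0) : ν.map T ≪ ν := by
  have h1 : ν ≪ ν.map T.symm :=
    (withDensity_absolutelyContinuous'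
      ((measurable_pullbackDensity ν).comp measurable_prodMk_left).aemeasurable h).trans
      (withDensity_pullbackDensity_le ν T).absolutelyContinuous
  have h2 := h1.map T.measurable
  rwa [map_symm_map] at h2

/-- Transporting by T⁻¹, the density of T_*ν at Tξ is that of ν with respect to T⁻¹_*ν at ξ, the
reciprocal of the pulled back density. -/
theorem ae_logDensity_eq {T : CircleHomeo} (h : ν.map T ≪ ν) :
    ∀ᵐ ξ ∂ν, pullbackDensity ν (T, ξ) ≠ 0 ∧
      logDensity ν T ξ = -Real.log (pullbackDensity ν (T, ξ)).toReal := by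
  have h1 : ν ≪ ν.map T.symm := by
    have h2 := h.map T.symm.measurable
    rwa [map_map_symm] at h2
  have h2 := h1.ae_eq (T.measurableEmbedding.rnDeriv_map ν (ν.map T.symm))
  rw [map_symm_map] at h2
  have h3 := h1.ae_le (Measure.rnDeriv_ne_top ν (ν.map T.symm))
  filter_upwards [h2, h3, Measure.inv_rnDeriv h1, pullbackDensity_ae_eq ν T] with ξ a b c d
  have e : pullbackDensity ν (T, ξ) = (ν.rnDeriv (ν.map T.symm) ξ)⁻¹ := by
    rw [d, ← c]; rfl
  refine ⟨by rw [e]; exact ENNReal.inv_ne_zero.2 b, ?_⟩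
  rw [logDensity, a, e, ENNReal.toReal_inv, Real.log_inv, neg_neg]

theorem iSup_ofReal_truncRate {y : ℝ≥0∞} (hy : y ≠ 0) (hy' : y ≠ ∞) :
    ⨆ K : ℕ, ENNReal.ofReal (truncRate K y) = ENNReal.ofReal (-Real.log y.toReal) := by
  have hpos : 0 < y.toReal := ENNReal.toReal_pos hy hy'
  apply le_antisymm
  · refine iSup_le fun K => ENNReal.ofReal_le_ofReal (neg_le_neg ?_)
    exact Real.log_le_log hpos (le_max_left _ _)
  · obtain ⟨K, hK⟩ := exists_nat_ge (-Real.log y.toReal)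
    refine le_iSup_of_le K (ENNReal.ofReal_le_ofReal ?_)
    rw [truncRate, max_eq_left]
    rw [← Real.le_log_iff_exp_le hpos]
    linarith

theorem monotone_truncRate (y : ℝ≥0∞) : Monotone fun K : ℕ => truncRate K y := by
  intro K K' h
  refine neg_le_neg (Real.log_le_log (lt_max_of_lt_right (Real.exp_pos _)) ?_)
  refine max_le_max le_rfl (Real.exp_le_exp.2 (neg_le_neg ?_))
  exact_mod_cast h

theorem IsStationary.furstenbergEntropy_le (hν : IsStationary μ ν) :
    furstenbergEntropy μ ν ≤ ((integralContractionExponent μ ν : ℝ≥0∞) : EReal) := by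
  have hqm := measurable_pullbackDensity ν
  have hneg := lintegral_ofReal_log_pullbackDensity_ne_top μ ν
  have hKm : ∀ K : ℕ, Measurable fun p => ENNReal.ofReal (truncRate K (pullbackDensity ν p)) :=
    fun K => ((measurable_truncRate K).comp hqm).ennreal_ofReal
  have hlogm : Measurable fun p => Real.log (pullbackDensity ν p).toReal :=
    Real.measurable_log.comp hqm.ennreal_toReal
  rw [furstenbergEntropy]
  split_ifs with hac
  · have hpos : ∫⁻ T, ∫⁻ ξ, ENNReal.ofReal (logDensity ν T ξ) ∂ν ∂μ =
        ∫⁻ p, ENNReal.ofReal (-Real.log (pullbackDensity ν p).toReal) ∂μ.prod ν := by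
      rw [lintegral_prod _ hlogm.fun_neg.ennreal_ofReal.aemeasurable]
      refine lintegral_congr_ae ?_
      filter_upwards [hac] with T hT
      refine lintegral_congr_ae ?_
      filter_upwards [ae_logDensity_eq hT] with ξ hξ
      rw [hξ.2]
    have hnegeq : ∫⁻ T, ∫⁻ ξ, ENNReal.ofReal (-logDensity ν T ξ) ∂ν ∂μ =
        ∫⁻ p, ENNReal.ofReal (Real.log (pullbackDensity ν p).toReal) ∂μ.prod ν := by
      rw [lintegral_prod _ hlogm.ennreal_ofReal.aemeasurable]
      refine lintegral_congr_ae ?_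
      filter_upwards [hac] with T hT
      refine lintegral_congr_ae ?_
      filter_upwards [ae_logDensity_eq hT] with ξ hξ
      rw [hξ.2, neg_neg]
    have hq0 : ∀ᵐ p ∂μ.prod ν, pullbackDensity ν p ≠ 0 := by
      have hm : MeasurableSet {p | pullbackDensity ν p ≠ 0} :=
        hqm (measurableSet_singleton 0).compl
      rw [Measure.ae_prod_iff_ae_ae hm]
      filter_upwards [hac] with T hT
      exact (ae_logDensity_eq hT).mono fun ξ hξ => hξ.1
    have hqfin : ∀ᵐ p ∂μ.prod ν, pullbackDensity ν p < ∞ :=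
      ae_lt_top hqm
        (ne_top_of_le_ne_top ENNReal.one_ne_top (lintegral_prod_pullbackDensity_le μ ν))
    have hle : ∫⁻ p, ENNReal.ofReal (-Real.log (pullbackDensity ν p).toReal) ∂μ.prod ν ≤
        integralContractionExponent μ ν +
          ∫⁻ p, ENNReal.ofReal (Real.log (pullbackDensity ν p).toReal) ∂μ.prod ν := by
      calc _ = ∫⁻ p, ⨆ K : ℕ, ENNReal.ofReal (truncRate K (pullbackDensity ν p)) ∂μ.prod ν := by
            refine lintegral_congr_ae ?_
            filter_upwards [hq0, hqfin] with p h1 h2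
            rw [iSup_ofReal_truncRate h1 h2.ne]
        _ = ⨆ K : ℕ, ∫⁻ p, ENNReal.ofReal (truncRate K (pullbackDensity ν p)) ∂μ.prod ν :=
            lintegral_iSup hKm fun K K' h p =>
              ENNReal.ofReal_le_ofReal (monotone_truncRate _ h)
        _ ≤ _ := iSup_le fun K => hν.lintegral_ofReal_truncRate_le (Nat.cast_nonneg K)
    rw [hpos, hnegeq]
    refine EReal.sub_le_of_le_add ?_
    rw [← EReal.coe_ennreal_add]
    exact EReal.coe_ennreal_le_coe_ennreal_iff.2 hle
  -- Without absolute continuity the density vanishes on a set of positive measure. There the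
  -- truncated rate equals K, so its integrals are unbounded in K and the contraction integral must
  -- be ∞.
  · have hp0 : μ.prod ν {p | pullbackDensity ν p = 0} ≠ 0 := by
      intro h0
      have h1 : ∀ᵐ p ∂μ.prod ν, pullbackDensity ν p ≠ 0 := by
        rw [ae_iff]
        simpa using h0
      refine hac ?_
      filter_upwards [Measure.ae_ae_of_ae_prod h1] with T hT
      exact absolutelyContinuous_of_ae_pullbackDensity_ne_zero hT
    have htop : integralContractionExponent μ ν = ∞ := by
      by_contra hne
      obtain ⟨K, hK⟩ := ENNReal.exists_nat_mul_gt hp0 (ENNReal.add_ne_top.2 ⟨hne, hneg⟩)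
      refine absurd hK (not_lt.2 (le_trans ?_
        (hν.lintegral_ofReal_truncRate_le (Nat.cast_nonneg K))))
      have hm : MeasurableSet {p | pullbackDensity ν p = 0} := hqm (measurableSet_singleton 0)
      rw [← lintegral_indicator_const hm]
      refine lintegral_mono fun p => Set.indicator_apply_le' (fun hp => ?_) fun _ => bot_le
      have hp' : pullbackDensity ν p = 0 := hp
      rw [hp', truncRate, ENNReal.toReal_zero, max_eq_right (Real.exp_pos _).le, Real.log_exp,
        neg_neg, ENNReal.ofReal_natCast]
    rw [htop]
    exact le_rfl

theorem truncRate_two_add_sub_one_nonneg (y : ℝ≥0∞) : 0 ≤ truncRate 2 y + (y.toReal - 1) := by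
  rw [truncRate]
  rcases le_total (Real.exp (-2)) y.toReal with h | h
  · rw [max_eq_left h]
    linarith [Real.log_le_sub_one_of_pos ((Real.exp_pos _).trans_le h)]
  · rw [max_eq_right h, Real.log_exp]
    linarith [ENNReal.toReal_nonneg (a := y)]

/-- Any truncation level above 1 would do: in the truncated range the sum is at least 2 − 1 > 0, so
equality can only come from log y = y − 1. -/
theorem toReal_eq_one_of_truncRate_two {y : ℝ≥0∞} (hy : truncRate 2 y + (y.toReal - 1) = 0) :
    y.toReal = 1 := by
  rw [truncRate] at hy
  rcases le_total (Real.exp (-2)) y.toReal with h | h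
  · rw [max_eq_left h] at hy
    by_contra hne
    linarith [Real.log_lt_sub_one_of_pos ((Real.exp_pos _).trans_le h) hne]
  · rw [max_eq_right h, Real.log_exp] at hy
    linarith [ENNReal.toReal_nonneg (a := y)]

theorem IsStationary.ae_map_eq_of_integralContractionExponent_eq_zero (hν : IsStationary μ ν)
    (h : integralContractionExponent μ ν = 0) : ∀ᵐ T : CircleHomeo ∂μ, ν.map T = ν := by
  have hi := integrable_truncRate_pullbackDensity μ ν (K := 2) (by norm_num)
  have hq := integrable_toReal_pullbackDensity μ ν
  have h1 : ∫ p, truncRate 2 (pullbackDensity ν p) ∂μ.prod ν ≤ 0 := by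
    have h2 := hν.ofReal_integral_truncRate_le (K := 2) (by norm_num)
    rw [h] at h2
    exact ENNReal.ofReal_eq_zero.1 (le_antisymm h2 bot_le)
  have h2 : ∫ p, (pullbackDensity ν p).toReal ∂μ.prod ν ≤ 1 := by
    have hqfin : ∀ᵐ p ∂μ.prod ν, pullbackDensity ν p < ∞ :=
      ae_lt_top (measurable_pullbackDensity ν)
        (ne_top_of_le_ne_top ENNReal.one_ne_top (lintegral_prod_pullbackDensity_le μ ν))
    rw [integral_toReal (measurable_pullbackDensity ν).aemeasurable hqfin]
    exact ENNReal.toReal_le_of_le_ofReal zero_le_one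
      (by simpa using lintegral_prod_pullbackDensity_le μ ν)
  have hq1 : Integrable (fun p => (pullbackDensity ν p).toReal - 1) (μ.prod ν) :=
    hq.sub (integrable_const 1)
  have h3 : ∫ p, (truncRate 2 (pullbackDensity ν p) + ((pullbackDensity ν p).toReal - 1))
      ∂μ.prod ν = 0 := by
    refine le_antisymm ?_ (integral_nonneg fun p => truncRate_two_add_sub_one_nonneg _)
    rw [integral_add hi hq1, integral_sub hq (integrable_const 1)]
    simp only [integral_const, probReal_univ, smul_eq_mul, mul_one]
    linarith
  have h4 := (integral_eq_zero_iff_of_nonneg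
    (fun p => truncRate_two_add_sub_one_nonneg (pullbackDensity ν p)) (hi.add hq1)).1 h3
  filter_upwards [Measure.ae_ae_of_ae_prod h4] with T hT
  have h5 : (fun ξ => pullbackDensity ν (T, ξ)) =ᵐ[ν] 1 := by
    filter_upwards [hT] with ξ hξ
    have h6 := toReal_eq_one_of_truncRate_two hξ
    exact (ENNReal.toReal_eq_one_iff _).1 h6
  -- Density 1 only identifies the absolutely continuous part; equality of the total masses then
  -- excludes a singular part.
  have h6 : ν ≤ ν.map T.symm := by
    have h7 := withDensity_pullbackDensity_le ν T
    rwa [withDensity_congr_ae h5, withDensity_one] at h7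
  have h7 : ν = ν.map T.symm := Measure.eq_of_le_of_isProbabilityMeasure h6
  conv_lhs => rw [h7]
  exact map_symm_map ν T

end RandomCircle

theorem mainTheorem4
    (μ : Measure CircleHomeo) [IsProbabilityMeasure μ]
    (ν : Measure UnitAddCircle) [IsProbabilityMeasure ν]
    (hν : RandomCircle.IsStationary μ ν) :
    RandomCircle.furstenbergEntropy μ ν
        ≤ ((RandomCircle.integralContractionExponent μ ν : ℝ≥0∞) : EReal) ∧
      ((∀ᵐ p ∂(RandomCircle.pathMeasure μ ν),
          RandomCircle.contractionExponent p.1 p.2 = 0) →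
        ∀ᵐ T : CircleHomeo ∂μ, ν.map T = ν) := by
  refine ⟨hν.furstenbergEntropy_le, fun h => ?_⟩
  refine hν.ae_map_eq_of_integralContractionExponent_eq_zero ?_
  have h1 : (fun p : (ℕ → CircleHomeo) × UnitAddCircle =>
      (RandomCircle.contractionExponent p.1 p.2).toENNReal)
        =ᵐ[RandomCircle.pathMeasure μ ν] fun _ => 0 := by
    filter_upwards [h] with p hp
    rw [hp, EReal.toENNReal_zero]
  rw [RandomCircle.integralContractionExponent, lintegral_congr_ae h1, lintegral_zero]
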